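/- **Theorem (Profile decomposition).** Let $d\ge 1$ and $\frac{8}{d}<\alpha<2^\star$, where $2^\star=\infty$ if $d\le 4$ and $2^\star=\frac{8}{d-4}$ if $d\ge 5$. Put $\gamma_c=\frac d2-\frac4\alpha$ and $\alpha_c=\frac{2d}{d-2\gamma_c}=\frac{d\alpha}{4}$. Let $\mathcal S_0$ be the space of Schwartz functions $\phi:\mathbb R^d\to\mathbb C$ with $D^\beta\hat\phi(0)=0$ for all $\beta\in\mathbb N^d$, let $\mathcal S_0'$ be its topological dual, and for $\gamma\in\mathbb R$ let $\dot H^\gamma=\{u\in\mathcal S_0' : \|u\|_{\dot H^\gamma}:=\||\nabla|^\gamma u\|_{L^2}<\infty\}$. An element of $\dot H^{\gamma_c}$ is regarded as a function on $\mathbb R^d$ through its (a.e. unique) representative in $L^{\alpha_c}$. Let $(v_n)_{n\ge1}$ be a bounded sequence in $\dot H^{\gamma_c}\cap\dot H^2$. Then there exist a subsequence of $(v_n)$ (still denoted $(v_n)$), a family $(x_n^j)_{n\ge 1}$, $j\ge1$, of sequences in $\mathbb R^d$, and a sequence $(V^j)_{j\ge1}$ of functions in $\dot H^{\gamma_c}\cap\dot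 H^2$ such that: * for every $k\ne j$, $|x_n^k-x_n^j|\to\infty$ as $n\to\infty$; * for every $l\ge1$, every $n$ and every $x\in\mathbb R^d$, $$v_n(x)=\sum_{j=1}^l V^j(x-x_n^j)+v_n^l(x),$$ where the remainders $v_n^l\in\dot H^{\gamma_c}\cap\dot H^2$ satisfy, for every $q\in(\alpha_c,2+2^\star)$, $$\limsup_{n\to\infty}\|v_n^l\|_{L^q}\to0\quad\text{as } l\to\infty;$$ * for every $l\ge1$, as $n\to\infty$, $$\|v_n\|_{\dot H^{\gamma_c}}^2=\sum_{j=1}^l\|V^j\|_{\dot H^{\gamma_c}}^2+\|v_n^l\|_{\dot H^{\gamma_c}}^2+o_n(1),\qquad \|v_n\|_{\dot H^2}^2=\sum_{j=1}^l\|V^j\|_{\dot H^2}^2+\|v_n^l\|_{\dot H^2}^2+o_n(1).$$ -/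

import Mathlib

open MeasureTheory Filter Topology FourierTransform
open scoped ENNReal SchwartzMap

noncomputable section

/-- The critical Sobolev exponent `γ_c = d/2 - 4/α`. -/
def gammaC (d : ℕ) (α : ℝ) : ℝ := (d : ℝ) / 2 - 4 / α

/-- The critical Lebesgue exponent `α_c = 2d / (d - 2γ_c)` (which equals `dα/4`). -/
def alphaC (d : ℕ) (α : ℝ) : ℝ := 2 * (d : ℝ) / ((d : ℝ) - 2 * gammaC d α)

/-- The energy exponent `2^⋆`: it is `∞` for `d ≤ 4` and `8 / (d - 4)` for `d ≥ 5`. -/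
def twoUpperStar (d : ℕ) : ℝ≥0∞ :=
  if d ≤ 4 then ⊤ else ENNReal.ofReal (8 / ((d : ℝ) - 4))

/-- The space `𝓢₀` of Schwartz functions on `ℝ^d` all of whose Fourier derivatives vanish at the
origin, with the topology induced by the Schwartz space. -/
def SchwartzZero (d : ℕ) : Submodule ℂ 𝓢(EuclideanSpace ℝ (Fin d), ℂ) where
  carrier := {φ | ∀ k : ℕ, iteratedFDeriv ℝ k (𝓕 φ : 𝓢(EuclideanSpace ℝ (Fin d), ℂ)) 0 = 0}
  zero_mem' := by
    intro k
    have h : (𝓕 (0 : 𝓢(EuclideanSpace ℝ (Fin d), ℂ))) = 0 :=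
      (SchwartzMap.fourierTransformCLM ℂ).map_zero
    rw [h]
    have h0 : ((0 : 𝓢(EuclideanSpace ℝ (Fin d), ℂ)) : EuclideanSpace ℝ (Fin d) → ℂ)
      = fun _ => 0 := rfl
    rw [h0, iteratedFDeriv_fun_zero]
    rfl
  add_mem' := by
    intro φ ψ hφ hψ k
    have h : (𝓕 (φ + ψ)) = 𝓕 φ + 𝓕 ψ := FourierAdd.fourier_add φ ψ
    have h0 : ((𝓕 φ + 𝓕 ψ : 𝓢(EuclideanSpace ℝ (Fin d), ℂ)) : EuclideanSpace ℝ (Fin d) → ℂ)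
      = (𝓕 φ : 𝓢(EuclideanSpace ℝ (Fin d), ℂ)) + (𝓕 ψ : 𝓢(EuclideanSpace ℝ (Fin d), ℂ)) := rfl
    rw [h, h0, iteratedFDeriv_add_apply ((𝓕 φ).smooth k).contDiffAt ((𝓕 ψ).smooth k).contDiffAt,
      hφ k, hψ k, add_zero]
  smul_mem' := by
    intro c φ hφ k
    have h : (𝓕 (c • φ)) = c • 𝓕 φ := FourierSMul.fourier_smul c φ
    have h0 : ((c • 𝓕 φ : 𝓢(EuclideanSpace ℝ (Fin d), ℂ)) : EuclideanSpace ℝ (Fin d) → ℂ)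
      = c • (𝓕 φ : 𝓢(EuclideanSpace ℝ (Fin d), ℂ)) := rfl
    rw [h, h0, iteratedFDeriv_const_smul_apply ((𝓕 φ).smooth k).contDiffAt, hφ k, smul_zero]

/-- The topological dual `𝓢₀'` (that is, tempered distributions modulo polynomials). -/
abbrev SchwartzZeroDual (d : ℕ) : Type := SchwartzZero d →L[ℂ] ℂ

/-- The functional `φ ↦ ∫ f φ` on `𝓢₀` attached to a function `f`. -/
def pairing {d : ℕ} (f : EuclideanSpace ℝ (Fin d) → ℂ) (φ : SchwartzZero d) : ℂ :=
  ∫ x, f x * (φ : 𝓢(EuclideanSpace ℝ (Fin d), ℂ)) x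

/-- The function `g` is the Fourier transform of the functional `u` on `𝓢₀`:
`⟨u, φ⟩ = ∫ g 𝓕⁻¹φ` for all `φ` in `𝓢₀`. Such a `g` is unique almost everywhere. -/
def IsFourierFunction {d : ℕ} (u : SchwartzZero d → ℂ) (g : EuclideanSpace ℝ (Fin d) → ℂ) : Prop :=
  AEStronglyMeasurable g volume ∧
    ∀ φ : SchwartzZero d,
      Integrable (fun ξ => g ξ * (𝓕⁻ (φ : 𝓢(EuclideanSpace ℝ (Fin d), ℂ)) :
        𝓢(EuclideanSpace ℝ (Fin d), ℂ)) ξ) volume ∧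
      u φ = ∫ ξ, g ξ * (𝓕⁻ (φ : 𝓢(EuclideanSpace ℝ (Fin d), ℂ)) :
        𝓢(EuclideanSpace ℝ (Fin d), ℂ)) ξ

/-- The homogeneous Sobolev norm `‖|∇|^γ u‖_{L²}`, with values in `[0, ∞]`. Here `|∇|^γ` is the
Fourier multiplier with symbol `(2π|ξ|)^γ` (the Fourier transform being normalised with kernel
`exp(-2πi x·ξ)`, which is unitary on `L²`). The infimum runs over the almost everywhere unique
Fourier transform `g` of `u`, and is `∞` if there is none. -/
def hdotENorm {d : ℕ} (γ : ℝ) (u : SchwartzZero d → ℂ) : ℝ≥0∞ :=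
  ⨅ (g : EuclideanSpace ℝ (Fin d) → ℂ) (_ : IsFourierFunction u g),
    eLpNorm (fun ξ => (((2 * Real.pi * ‖ξ‖) ^ γ : ℝ) : ℂ) * g ξ) 2 volume

/-- The homogeneous Sobolev norm as a real number (meaningful when it is finite). -/
def hdotNorm {d : ℕ} (γ : ℝ) (u : SchwartzZero d → ℂ) : ℝ := (hdotENorm γ u).toReal

end

/-! Multiply the Fourier transform of `u` by the weight `(2π|ξ|)^γ + (2π|ξ|)²`. The space `Ḣ^γ ∩ Ḣ²`
then becomes `L²`, translations become modulations by characters, and the two homogeneous norms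
become `‖B h‖` for multipliers `B` of modulus at most one, which commute with modulations. By
Riemann–Lebesgue the coefficients `⟨h, U x k⟩` vanish as `|x| → ∞`, so profiles in frames that move
apart do not interact.

In this Hilbert space the profiles are extracted greedily (`exists_greedy_profiles`). Among the
translation frames that move away from all earlier ones, one is taken whose weak limit has at least
half of the largest possible norm, and that limit is subtracted. Weak convergence kills the cross
terms, which gives the Pythagorean expansions (`tendsto_pythagoras`). Hence `∑ ‖V j‖²` is finite,
`‖V l‖ → 0`, and by near-maximality every weak limit of translates of the `l`-th remainder is small.
All limits are taken along one nonprincipal ultrafilter; the subsequence is extracted once, at the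
end, from countably many statements (`exists_strictMono_tendsto`).

For smallness in `L^q`, write `q = 2d / (d - 2s)` with `γ < s < 2`. Outside a large frequency shell
the `Ḣ^s` norm is a small multiple of the weighted norm, so the Sobolev embedding
(`exists_eLpNorm_le_of_hasFourier`) applies. Inside the shell, the values of the function are inner
products of translates with a fixed vector (`fourierInv_shell_unweight`), hence uniformly small, and
the bounded `L²` norm gives `L^q` by interpolation (`exists_eLpNorm_le_shell`). -/

/-! ### Profiles for a dispersive action on a Hilbert space -/

section HilbertProfiles

set_option linter.unusedSectionVars false

variable {H : Type*} [NormedAddCommGroup H] [InnerProductSpace ℂ H]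

/-- Weak convergence of a sequence in a Hilbert space along a filter. -/
def WeakTendsto (F : Filter ℕ) (f : ℕ → H) (V : H) : Prop :=
  ∀ k : H, Tendsto (fun n => inner ℂ k (f n)) F (𝓝 (inner ℂ k V))

theorem WeakTendsto.sub {F : Filter ℕ} {f g : ℕ → H} {V W : H} (hf : WeakTendsto F f V)
    (hg : WeakTendsto F g W) : WeakTendsto F (fun n => f n - g n) (V - W) := by
  intro k
  simpa only [inner_sub_right] using (hf k).sub (hg k)

theorem weakTendsto_const (F : Filter ℕ) (V : H) : WeakTendsto F (fun _ => V) V :=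
  fun _ => tendsto_const_nhds

/-- Banach–Alaoglu. Along an ultrafilter the limit exists without passing to a subsequence, and
separability of `H` plays no role. -/
theorem exists_weakTendsto_of_bounded [CompleteSpace H] (𝒰 : Ultrafilter ℕ) {f : ℕ → H} {C : ℝ}
    (hf : ∀ n, ‖f n‖ ≤ C) : ∃ V, WeakTendsto 𝒰 f V := by
  have hc := WeakDual.isCompact_closedBall (𝕜 := ℂ) (E := H) 0 C
  obtain ⟨T, -, hT⟩ := hc.ultrafilter_le_nhds
    (𝒰.map fun n => (StrongDual.toWeakDual (InnerProductSpace.toDual ℂ H (f n)))) (by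
      rw [le_principal_iff, Ultrafilter.coe_map, mem_map]
      refine Filter.Eventually.of_forall fun n => ?_
      simpa using hf n)
  refine ⟨(InnerProductSpace.toDual ℂ H).symm (WeakDual.toStrongDual T), fun k => ?_⟩
  have h1 : Tendsto (fun n => (StrongDual.toWeakDual (InnerProductSpace.toDual ℂ H (f n))) k) 𝒰
      (𝓝 (T k)) := (WeakDual.eval_continuous k).continuousAt.tendsto.comp hT
  have h2 : ∀ V : H, inner ℂ k V = starRingEnd ℂ (inner ℂ V k) := fun V =>
    (inner_conj_symm k V).symm
  simp only [h2]
  refine (Complex.continuous_conj.tendsto _).comp ?_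
  rw [InnerProductSpace.toDual_symm_apply]
  exact h1

/-- A strongly continuous isometric action of a vector space on a Hilbert space, whose matrix
coefficients vanish at infinity. -/
structure IsDispersive {E : Type*} [NormedAddCommGroup E] (U : E → H →ₗᵢ[ℂ] H) : Prop where
  map_zero : ∀ h, U 0 h = h
  map_add : ∀ x y h, U (x + y) h = U x (U y h)
  continuous_inner : ∀ h k, Continuous fun x => inner ℂ h (U x k)
  tendsto_inner : ∀ h k, Tendsto (fun x => inner ℂ h (U x k)) (cocompact E) (𝓝 0)

namespace IsDispersive

variable {E : Type*} [NormedAddCommGroup E] {U : E → H →ₗᵢ[ℂ] H}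

theorem map_neg_map (hU : IsDispersive U) (x : E) (h : H) : U (-x) (U x h) = h := by
  rw [← hU.map_add, neg_add_cancel, hU.map_zero]

theorem inner_map (hU : IsDispersive U) (x : E) (h k : H) :
    inner ℂ h (U x k) = inner ℂ (U (-x) h) k := by
  rw [← (U (-x)).inner_map_map h, hU.map_neg_map]

/-- For isometries weak continuity is strong continuity, since `‖U y h - U x h‖² = 2‖h‖² - 2 Re ⟨U x
h, U y h⟩`. -/
theorem continuous (hU : IsDispersive U) (h : H) : Continuous fun x => U x h := by
  rw [continuous_iff_continuousAt]
  intro x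
  rw [ContinuousAt, tendsto_iff_norm_sub_tendsto_zero]
  have h1 : Tendsto (fun y => 2 * ‖h‖ ^ 2 - 2 * RCLike.re (inner ℂ (U x h) (U y h))) (𝓝 x)
      (𝓝 (2 * ‖h‖ ^ 2 - 2 * RCLike.re (inner ℂ (U x h) (U x h)))) :=
    (((RCLike.continuous_re.comp (hU.continuous_inner (U x h) h)).const_mul 2).tendsto x).const_sub _
  have h2 : ∀ y, ‖U y h - U x h‖ = √(2 * ‖h‖ ^ 2 - 2 * RCLike.re (inner ℂ (U x h) (U y h))) := by
    intro y
    rw [← Real.sqrt_sq (norm_nonneg (U y h - U x h)), @norm_sub_sq ℂ, (U x).norm_map,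
      (U y).norm_map, inner_re_symm]
    congr 1; ring
  simp only [h2]
  rw [inner_self_eq_norm_sq, (U x).norm_map, sub_self] at h1
  simpa [Function.comp_def] using (Real.continuous_sqrt.tendsto 0).comp h1

/-- The action moves onto the test vector, where it converges in norm. -/
theorem weakTendsto_map (hU : IsDispersive U) {F : Filter ℕ} {f : ℕ → H} {V : H} {C : ℝ}
    (hf : ∀ n, ‖f n‖ ≤ C) (hV : WeakTendsto F f V) {y : ℕ → E} {z : E} (hy : Tendsto y F (𝓝 z)) :
    WeakTendsto F (fun n => U (y n) (f n)) (U z V) := by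
  intro k
  simp only [hU.inner_map]
  have h1 : Tendsto (fun n => inner ℂ (U (-y n) k - U (-z) k) (f n)) F (𝓝 0) := by
    have h2 : Tendsto (fun n => ‖U (-y n) k - U (-z) k‖ * C) F (𝓝 0) := by
      have := (((hU.continuous k).tendsto (-z)).comp hy.neg)
      simpa using (tendsto_iff_norm_sub_tendsto_zero.1 this).mul_const C
    refine squeeze_zero_norm (fun n => ?_) h2
    exact (norm_inner_le_norm _ _).trans (by gcongr; exact hf n)
  have h3 := h1.add (hV (U (-z) k))
  simpa [inner_sub_left] using h3

theorem weakTendsto_map_zero [ProperSpace E] (hU : IsDispersive U) {F : Filter ℕ} {y : ℕ → E}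
    (hy : Tendsto (fun n => ‖y n‖) F atTop) (V : H) : WeakTendsto F (fun n => U (y n) V) 0 := by
  intro k
  rw [inner_zero_right]
  refine (hU.tendsto_inner k V).comp ?_
  rwa [← Metric.cobounded_eq_cocompact, ← tendsto_norm_atTop_iff_cobounded]

/-- The concentration points that avoid the sequences of a given list. -/
def Admissible (U : E → H →ₗᵢ[ℂ] H) (F : Filter ℕ) (r : ℕ → H) (L : List (ℕ → E)) (x : ℕ → E)
    (V : H) : Prop :=
  (∀ y ∈ L, Tendsto (fun n => ‖x n - y n‖) F atTop) ∧ WeakTendsto F (fun n => U (-x n) (r n)) V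

/-- Guarantees that the greedy choice always has a candidate. -/
theorem exists_avoiding [NormedSpace ℝ E] [Nontrivial E] (L : List (ℕ → E)) :
    ∃ x : ℕ → E, ∀ y ∈ L, Tendsto (fun n => ‖x n - y n‖) atTop atTop := by
  have h : ∀ n : ℕ, ∃ z : E, (n : ℝ) + (L.map fun y => ‖y n‖).sum ≤ ‖z‖ := fun n =>
    NormedSpace.exists_lt_norm ℝ E _ |>.imp fun _ => le_of_lt
  choose x hx using h
  refine ⟨x, fun y hy => tendsto_atTop_mono (fun n => ?_) tendsto_natCast_atTop_atTop⟩
  have h1 : ‖y n‖ ≤ (L.map fun y => ‖y n‖).sum :=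
    List.single_le_sum (by simp) _ (List.mem_map_of_mem hy)
  linarith [hx n, norm_sub_norm_le (x n) (y n)]

theorem norm_weakLimit_le {F : Filter ℕ} [F.NeBot] {f : ℕ → H} {V : H} {C : ℝ}
    (hf : ∀ n, ‖f n‖ ≤ C) (hV : WeakTendsto F f V) : ‖V‖ ≤ C := by
  have h1 : ‖inner ℂ V V‖ ≤ ‖V‖ * C := le_of_tendsto (hV V).norm
    (Eventually.of_forall fun n => (norm_inner_le_norm _ _).trans (by gcongr; exact hf n))
  rw [inner_self_eq_norm_sq_to_K] at h1
  by_contra! hlt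
  have h0 : 0 < ‖V‖ := ((norm_nonneg _).trans (hf 0)).trans_lt hlt
  have h2 : ‖V‖ ^ 2 ≤ ‖V‖ * C := by simpa using h1
  nlinarith

/-- The norms of admissible weak limits are bounded by that of `r`, so they have a finite supremum,
of which more than half is attained when it is positive. Boundedness of `r` stands inside the
existential so that `choose` yields a function of every pair `(r, L)`, on which one can recurse. -/
theorem exists_admissible_almost_maximal [CompleteSpace H] [NormedSpace ℝ E] [Nontrivial E]
    (U : E → H →ₗᵢ[ℂ] H) (r : ℕ → H) (L : List (ℕ → E)) :
    ∃ p : (ℕ → E) × H, (∃ C, ∀ n, ‖r n‖ ≤ C) → Admissible U (hyperfilter ℕ) r L p.1 p.2 ∧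
      ∀ x V, Admissible U (hyperfilter ℕ) r L x V → ‖V‖ ≤ 2 * ‖p.2‖ := by
  by_cases hr : ∃ C, ∀ n, ‖r n‖ ≤ C
  swap
  · exact ⟨(fun _ => 0, 0), fun h => absurd h hr⟩
  obtain ⟨C, hC⟩ := hr
  let S : Set ℝ := {t | ∃ x V, Admissible U (hyperfilter ℕ) r L x V ∧ t = ‖V‖}
  have hbdd : BddAbove S := by
    refine ⟨C, ?_⟩
    rintro _ ⟨x, V, hV, rfl⟩
    exact norm_weakLimit_le (fun n => ((U (-x n)).norm_map _).le.trans (hC n)) hV.2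
  obtain ⟨x₀, hx₀⟩ := exists_avoiding L
  obtain ⟨V₀, hV₀⟩ := exists_weakTendsto_of_bounded (hyperfilter ℕ)
    (fun n => ((U (-x₀ n)).norm_map (r n)).le.trans (hC n))
  have hadm : Admissible U (hyperfilter ℕ) r L x₀ V₀ :=
    ⟨fun y hy => (hx₀ y hy).mono_left Nat.hyperfilter_le_atTop, hV₀⟩
  have hle : ∀ x V, Admissible U (hyperfilter ℕ) r L x V → ‖V‖ ≤ sSup S :=
    fun x V h => le_csSup hbdd ⟨x, V, h, rfl⟩
  rcases le_or_gt (sSup S) 0 with h0 | h0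
  · exact ⟨(x₀, V₀), fun _ => ⟨hadm, fun x V h => by
      linarith [hle x V h, norm_nonneg V₀]⟩⟩
  · obtain ⟨_, ⟨x, V, hV, rfl⟩, hlt⟩ := exists_lt_of_lt_csSup
      (show S.Nonempty from ⟨_, x₀, V₀, hadm, rfl⟩) (half_lt_self h0)
    exact ⟨(x, V), fun _ => ⟨hV, fun y W h => by linarith [hle y W h]⟩⟩

/-- The remainder after removing the first `l` profiles. -/
def remainder (U : E → H →ₗᵢ[ℂ] H) (h : ℕ → H) (x : ℕ → ℕ → E) (V : ℕ → H) (l n : ℕ) : H :=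
  h n - ∑ j ∈ Finset.range l, U (x j n) (V j)

theorem remainder_succ (U : E → H →ₗᵢ[ℂ] H) (h : ℕ → H) (x : ℕ → ℕ → E) (V : ℕ → H) (l n : ℕ) :
    remainder U h x V (l + 1) n = remainder U h x V l n - U (x l n) (V l) := by
  simp only [remainder, Finset.sum_range_succ]; abel

theorem remainder_bounded (U : E → H →ₗᵢ[ℂ] H) {h : ℕ → H} {C : ℝ} (hh : ∀ n, ‖h n‖ ≤ C)
    (x : ℕ → ℕ → E) (V : ℕ → H) (l n : ℕ) :
    ‖remainder U h x V l n‖ ≤ C + ∑ j ∈ Finset.range l, ‖V j‖ := by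
  refine (norm_sub_le _ _).trans (add_le_add (hh n) ((norm_sum_le _ _).trans ?_))
  simp

theorem exists_greedy_profiles [CompleteSpace H] [NormedSpace ℝ E] [Nontrivial E]
    (U : E → H →ₗᵢ[ℂ] H) {h : ℕ → H} {C : ℝ} (hh : ∀ n, ‖h n‖ ≤ C) :
    ∃ (x : ℕ → ℕ → E) (V : ℕ → H), ∀ l,
      (∀ j < l, Tendsto (fun n => ‖x l n - x j n‖) (hyperfilter ℕ) atTop) ∧
      WeakTendsto (hyperfilter ℕ) (fun n => U (-x l n) (remainder U h x V l n)) (V l) ∧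
      ∀ (y : ℕ → E) (W : H), (∀ j < l, Tendsto (fun n => ‖y n - x j n‖) (hyperfilter ℕ) atTop) →
        WeakTendsto (hyperfilter ℕ) (fun n => U (-y n) (remainder U h x V l n)) W →
        ‖W‖ ≤ 2 * ‖V l‖ := by
  choose p hp using exists_admissible_almost_maximal (H := H) (E := E) U
  -- The state after `l` steps: the current remainder and the list of the frames already used.
  let S : ℕ → (ℕ → H) × List (ℕ → E) := fun l => Nat.rec (h, [])
    (fun _ s => (fun n => s.1 n - U ((p s.1 s.2).1 n) (p s.1 s.2).2, (p s.1 s.2).1 :: s.2)) l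
  let x : ℕ → ℕ → E := fun l => (p (S l).1 (S l).2).1
  let V : ℕ → H := fun l => (p (S l).1 (S l).2).2
  have hS1 : ∀ l, (S l).1 = remainder U h x V l := by
    intro l
    induction l with
    | zero => funext n; simp [remainder, S]
    | succ l ih =>
      funext n
      rw [remainder_succ, ← ih]
  have hS2 : ∀ l y, y ∈ (S l).2 ↔ ∃ j < l, y = x j := by
    intro l
    induction l with
    | zero => intro y; simp [S]
    | succ l ih =>
      intro y
      have : (S (l + 1)).2 = x l :: (S l).2 := rfl
      rw [this, List.mem_cons, ih]
      constructor
      · rintro (rfl | ⟨j, hj, rfl⟩)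
        exacts [⟨l, by omega, rfl⟩, ⟨j, by omega, rfl⟩]
      · rintro ⟨j, hj, rfl⟩
        rcases Nat.lt_succ_iff_lt_or_eq.1 hj with hj | rfl
        exacts [Or.inr ⟨j, hj, rfl⟩, Or.inl rfl]
  refine ⟨x, V, fun l => ?_⟩
  obtain ⟨⟨h1, h2⟩, h3⟩ := hp (S l).1 (S l).2
    ⟨_, fun n => by rw [hS1]; exact remainder_bounded U hh x V l n⟩
  have h4 : WeakTendsto (hyperfilter ℕ) (fun n => U (-x l n) ((S l).1 n)) (V l) := h2
  rw [hS1] at h4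
  refine ⟨fun j hj => h1 _ ((hS2 l _).2 ⟨j, hj, rfl⟩), h4, fun y W hy hW => h3 y W ⟨?_, ?_⟩⟩
  · intro z hz
    obtain ⟨j, hj, rfl⟩ := (hS2 l z).1 hz
    exact hy j hj
  · rw [hS1]; exact hW

/-- Along an ultrafilter a sequence that does not tend to infinity is eventually in some fixed ball,
so by compactness `x n - y n` converges. The two frames then differ by a convergent translation,
which preserves the weak limit zero. -/
theorem weakTendsto_zero_of_not_avoiding [ProperSpace E] (hU : IsDispersive U) {r : ℕ → H} {C : ℝ}
    (hr : ∀ n, ‖r n‖ ≤ C) {x y : ℕ → E}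
    (hx : WeakTendsto (hyperfilter ℕ) (fun n => U (-x n) (r n)) 0)
    (hy : ¬ Tendsto (fun n => ‖y n - x n‖) (hyperfilter ℕ) atTop) :
    WeakTendsto (hyperfilter ℕ) (fun n => U (-y n) (r n)) 0 := by
  rw [tendsto_atTop] at hy
  push Not at hy
  obtain ⟨R, hR⟩ := hy
  replace hR : ∀ᶠ n in (hyperfilter ℕ : Filter ℕ), x n - y n ∈ Metric.closedBall (0 : E) R := by
    refine hR.mono fun n hn => ?_
    rw [mem_closedBall_zero_iff, norm_sub_rev]
    exact hn.le
  obtain ⟨z, -, hz⟩ := (isCompact_closedBall (0 : E) R).ultrafilter_le_nhds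
    ((hyperfilter ℕ).map fun n => x n - y n) (by rwa [le_principal_iff])
  have h1 := hU.weakTendsto_map (fun n => ((U (-x n)).norm_map _).le.trans (hr n)) hx hz
  simp only [← hU.map_add, _root_.map_zero] at h1
  simpa [sub_eq_add_neg, add_comm, add_assoc] using h1

/-- Otherwise some `y n` violate the bound along the ultrafilter, and the weak limit of the
corresponding translates tests to at least `δ > ‖k‖ η` against `k`, contrary to Cauchy–Schwarz. This
makes the smallness uniform in `y`. -/
theorem eventually_norm_inner_le [CompleteSpace H] {r : ℕ → H} {C η : ℝ}
    (hr : ∀ n, ‖r n‖ ≤ C)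
    (hη : ∀ (y : ℕ → E) (W : H), WeakTendsto (hyperfilter ℕ) (fun n => U (-y n) (r n)) W → ‖W‖ ≤ η)
    (k : H) {δ : ℝ} (hδ : ‖k‖ * η < δ) :
    ∀ᶠ n in (hyperfilter ℕ : Filter ℕ), ∀ y, ‖inner ℂ k (U y (r n))‖ ≤ δ := by
  by_contra hcon
  rw [← Ultrafilter.frequently_iff_eventually, not_frequently] at hcon
  have h1 : ∀ n, ∃ y, (¬ ∀ y, ‖inner ℂ k (U y (r n))‖ ≤ δ) → δ ≤ ‖inner ℂ k (U (-y) (r n))‖ := by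
    intro n
    by_cases h : ∀ y, ‖inner ℂ k (U y (r n))‖ ≤ δ
    · exact ⟨0, fun h' => absurd h h'⟩
    · push Not at h
      obtain ⟨y, hy⟩ := h
      exact ⟨-y, fun _ => by rw [neg_neg]; exact hy.le⟩
  choose y hy using h1
  obtain ⟨W, hW⟩ := exists_weakTendsto_of_bounded (hyperfilter ℕ)
    (fun n => ((U (-y n)).norm_map (r n)).le.trans (hr n))
  have h2 : δ ≤ ‖inner ℂ k W‖ := ge_of_tendsto (hW k).norm (hcon.mono hy)
  have h3 := (norm_inner_le_norm k W (𝕜 := ℂ)).trans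
    (mul_le_mul_of_nonneg_left (hη y W hW) (norm_nonneg k))
  linarith

/-- Translated back, `r n` is `V` plus a sequence `w n` tending weakly to zero. As `B` commutes with
the isometries, the defect is the cross term `2 Re ⟨B* B V, w n⟩`. -/
theorem tendsto_norm_sq_sub (hU : IsDispersive U) {F : Filter ℕ} {r : ℕ → H} {x : ℕ → E} {V : H}
    (hV : WeakTendsto F (fun n => U (-x n) (r n)) V) [CompleteSpace H] (B : H →L[ℂ] H)
    (hB : ∀ y h, B (U y h) = U y (B h)) :
    Tendsto (fun n => ‖B (r n)‖ ^ 2 - (‖B V‖ ^ 2 + ‖B (r n - U (x n) V)‖ ^ 2)) F (𝓝 0) := by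
  have h1 : ∀ n, ‖B (r n)‖ ^ 2 - (‖B V‖ ^ 2 + ‖B (r n - U (x n) V)‖ ^ 2) =
      2 * RCLike.re (inner ℂ (B.adjoint (B V)) (U (-x n) (r n) - V)) := by
    intro n
    have h2 : ‖B (r n)‖ = ‖B V + B (U (-x n) (r n) - V)‖ := by
      rw [← _root_.map_add, add_sub_cancel, hB, (U (-x n)).norm_map]
    have h3 : ‖B (r n - U (x n) V)‖ = ‖B (U (-x n) (r n) - V)‖ := by
      rw [← (U (-x n)).norm_map, ← hB, map_sub, hU.map_neg_map]
    rw [h2, h3, @norm_add_sq ℂ, ContinuousLinearMap.adjoint_inner_left]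
    ring
  simp only [h1]
  have h4 := (hV.sub (weakTendsto_const F V)) (B.adjoint (B V))
  rw [sub_self, inner_zero_right] at h4
  simpa using ((RCLike.continuous_re.tendsto (0 : ℂ)).comp h4).const_mul 2

theorem tendsto_pythagoras (hU : IsDispersive U) [CompleteSpace H] {F : Filter ℕ} {h : ℕ → H}
    {x : ℕ → ℕ → E} {V : ℕ → H}
    (hV : ∀ l, WeakTendsto F (fun n => U (-x l n) (remainder U h x V l n)) (V l)) (B : H →L[ℂ] H)
    (hB : ∀ y h, B (U y h) = U y (B h)) (l : ℕ) :
    Tendsto (fun n => ‖B (h n)‖ ^ 2 - (∑ j ∈ Finset.range l, ‖B (V j)‖ ^ 2 +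
      ‖B (remainder U h x V l n)‖ ^ 2)) F (𝓝 0) := by
  induction l with
  | zero => simpa [remainder] using tendsto_const_nhds
  | succ l ih =>
    have h1 := ih.add (hU.tendsto_norm_sq_sub (hV l) B hB)
    rw [add_zero] at h1
    refine h1.congr fun n => ?_
    rw [remainder_succ, Finset.sum_range_succ]
    ring

/-- The hyperfilter refines both `F` and `atTop`, so `F ⊓ atTop` is nontrivial; being countably
generated, it admits a sequence tending to it. This replaces a diagonal extraction. -/
theorem exists_strictMono_tendsto {F : Filter ℕ} [F.IsCountablyGenerated]
    (hF : (hyperfilter ℕ : Filter ℕ) ≤ F) : ∃ σ : ℕ → ℕ, StrictMono σ ∧ Tendsto σ atTop F := by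
  have hne : (F ⊓ atTop).NeBot :=
    (inferInstance : (hyperfilter ℕ : Filter ℕ).NeBot).mono (le_inf hF Nat.hyperfilter_le_atTop)
  obtain ⟨u, hu⟩ := (F ⊓ atTop).exists_seq_tendsto
  rw [tendsto_inf] at hu
  obtain ⟨φ, hφ, hφ'⟩ := strictMono_subseq_of_tendsto_atTop hu.2
  exact ⟨u ∘ φ, hφ', hu.1.comp hφ.tendsto_atTop⟩

/-- Profile decomposition of a bounded sequence in a Hilbert space with respect to a dispersive
action: the remainders vanish asymptotically against every orbit of the test vectors `k i`, and
the squared norms decouple under every operator `B i` that commutes with the action. -/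
theorem exists_profile_decomposition [CompleteSpace H] [NormedSpace ℝ E] [Nontrivial E]
    [ProperSpace E] (hU : IsDispersive U) {h : ℕ → H} {C : ℝ} (hh : ∀ n, ‖h n‖ ≤ C)
    {ι κ : Type*} [Countable ι] [Countable κ] (k : κ → H) (B : ι → H →L[ℂ] H)
    (hB : ∀ i y h, B i (U y h) = U y (B i h)) :
    ∃ (σ : ℕ → ℕ) (x : ℕ → ℕ → E) (V : ℕ → H) (ε : κ → ℕ → ℝ), StrictMono σ ∧
      (∀ i j, i ≠ j → Tendsto (fun n => ‖x i n - x j n‖) atTop atTop) ∧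
      (∀ i, Tendsto (ε i) atTop (𝓝 0)) ∧
      (∀ i l, ∀ᶠ n in atTop, ∀ y, ‖inner ℂ (k i) (U y (remainder U (h ∘ σ) x V l n))‖ ≤ ε i l) ∧
      ∀ i l, Tendsto (fun n => ‖B i (h (σ n))‖ ^ 2 - (∑ j ∈ Finset.range l, ‖B i (V j)‖ ^ 2 +
        ‖B i (remainder U (h ∘ σ) x V l n)‖ ^ 2)) atTop (𝓝 0) := by
  obtain ⟨x, V, hxV⟩ := exists_greedy_profiles U hh
  have hr := remainder_bounded U hh x V
  have hx : ∀ i j, i ≠ j → Tendsto (fun n => ‖x i n - x j n‖) (hyperfilter ℕ) atTop := by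
    intro i j hij
    rcases lt_or_gt_of_ne hij with h' | h'
    · simpa only [norm_sub_rev] using (hxV j).1 i h'
    · exact (hxV i).1 j h'
  -- Seen from the frame of an extracted profile nothing is left: later profiles sit infinitely far
  -- away and tend weakly to zero there.
  have hzero : ∀ j l, j < l →
      WeakTendsto (hyperfilter ℕ) (fun n => U (-x j n) (remainder U h x V l n)) 0 := by
    intro j l hjl
    induction l, hjl using Nat.le_induction with
    | base =>
      have h1 := (hxV j).2.1.sub (weakTendsto_const _ (V j))
      rw [sub_self] at h1
      simpa only [remainder_succ, map_sub, hU.map_neg_map] using h1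
    | succ l hl ih =>
      have h1 := ih.sub (hU.weakTendsto_map_zero (hx l j (by omega)) (V l))
      rw [sub_self] at h1
      intro w
      refine (h1 w).congr fun n => ?_
      dsimp only
      rw [remainder_succ, map_sub, ← hU.map_add, sub_eq_neg_add (x l n)]
  -- Near-maximality extends to all frames: one that stays near an earlier frame only sees the weak
  -- limit zero.
  have hmax : ∀ l (y : ℕ → E) (W : H),
      WeakTendsto (hyperfilter ℕ) (fun n => U (-y n) (remainder U h x V l n)) W →
      ‖W‖ ≤ 2 * ‖V l‖ := by
    intro l y W hW
    by_cases hy : ∀ j < l, Tendsto (fun n => ‖y n - x j n‖) (hyperfilter ℕ) atTop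
    · exact (hxV l).2.2 y W hy hW
    · push Not at hy
      obtain ⟨j, hj, hy⟩ := hy
      have h0 := hU.weakTendsto_zero_of_not_avoiding (hr l) (hzero j l hj) hy
      have : inner ℂ W W = inner ℂ W (0 : H) := tendsto_nhds_unique (hW W) (h0 W)
      rw [inner_zero_right, inner_self_eq_zero] at this
      simp [this]
  have hpyth := fun (B : H →L[ℂ] H) hB l =>
    hU.tendsto_pythagoras (F := (hyperfilter ℕ : Filter ℕ)) (fun l => (hxV l).2.1) B hB l
  have hVsum : ∀ l, ∑ j ∈ Finset.range l, ‖V j‖ ^ 2 ≤ C ^ 2 := by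
    intro l
    have h1 := hpyth (ContinuousLinearMap.id ℂ H) (fun _ _ => rfl) l
    have h2 : Tendsto (fun n => ‖h n‖ ^ 2 - (∑ j ∈ Finset.range l, ‖V j‖ ^ 2 +
        ‖remainder U h x V l n‖ ^ 2) + ∑ j ∈ Finset.range l, ‖V j‖ ^ 2) (hyperfilter ℕ)
        (𝓝 (0 + ∑ j ∈ Finset.range l, ‖V j‖ ^ 2)) := h1.add_const _
    rw [zero_add] at h2
    refine le_of_tendsto h2 (Eventually.of_forall fun n => ?_)
    have h3 := pow_le_pow_left₀ (norm_nonneg _) (hh n) 2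
    nlinarith [sq_nonneg ‖remainder U h x V l n‖]
  have hVzero : Tendsto (fun l => ‖V l‖) atTop (𝓝 0) := by
    have h1 := (summable_of_sum_range_le (fun j => sq_nonneg ‖V j‖) hVsum).tendsto_atTop_zero
    simpa [Function.comp_def, Real.sqrt_sq] using (Real.continuous_sqrt.tendsto 0).comp h1
  -- The term `1 / (l + 1)` provides the strict inequality of `eventually_norm_inner_le`, even when
  -- `k i` or `V l` vanishes.
  let ε : κ → ℕ → ℝ := fun i l => ‖k i‖ * (2 * ‖V l‖) + 1 / ((l : ℝ) + 1)
  have hε : ∀ i, Tendsto (ε i) atTop (𝓝 0) := fun i => by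
    simpa [ε] using ((hVzero.const_mul 2).const_mul ‖k i‖).add
      (tendsto_one_div_add_atTop_nhds_zero_nat (𝕜 := ℝ))
  let G : κ × ℕ → Set ℕ := fun q =>
    {n | ∀ y, ‖inner ℂ (k q.1) (U y (remainder U h x V q.2 n))‖ ≤ ε q.1 q.2}
  let P : ι × ℕ → ℕ → ℝ := fun q n => ‖B q.1 (h n)‖ ^ 2 -
    (∑ j ∈ Finset.range q.2, ‖B q.1 (V j)‖ ^ 2 + ‖B q.1 (remainder U h x V q.2 n)‖ ^ 2)
  let D : {q : ℕ × ℕ // q.1 ≠ q.2} → ℕ → ℝ := fun q n => ‖x q.1.1 n - x q.1.2 n‖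
  -- Smallness, decoupling and separation are countably many conditions, so together they form one
  -- countably generated filter.
  obtain ⟨σ, hσ, hσF⟩ := exists_strictMono_tendsto
    (F := (⨅ q, 𝓟 (G q)) ⊓ (⨅ q, comap (P q) (𝓝 0)) ⊓ ⨅ q, comap (D q) atTop) (by
      refine le_inf (le_inf (le_iInf fun q => ?_) (le_iInf fun q => ?_)) (le_iInf fun q => ?_)
      · rw [le_principal_iff]
        exact eventually_norm_inner_le (hr q.2) (hmax q.2) (k q.1)
          (lt_add_of_pos_right _ (by positivity))
      · exact tendsto_iff_comap.1 (hpyth (B q.1) (hB q.1) q.2)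
      · exact tendsto_iff_comap.1 (hx _ _ q.2))
  simp only [tendsto_inf, tendsto_iInf, tendsto_comap_iff, tendsto_principal] at hσF
  refine ⟨σ, fun j n => x j (σ n), V, ε, hσ, fun i j hij => hσF.2 ⟨(i, j), hij⟩, hε,
    fun i l => hσF.1.1 (i, l), fun i l => hσF.1.2 (i, l)⟩

end IsDispersive
end HilbertProfiles

/-! ### Multipliers and modulations on `L²` -/

noncomputable section Multipliers

section MulLp

variable {X : Type*} [MeasurableSpace X] {μ : Measure X}

theorem memLp_mul_of_norm_le_one {a h : X → ℂ} (ha : AEStronglyMeasurable a μ)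
    (hb : ∀ ξ, ‖a ξ‖ ≤ 1) {p : ℝ≥0∞} (hh : MemLp h p μ) : MemLp (fun ξ => a ξ * h ξ) p μ := by
  refine hh.of_le (ha.mul hh.1) (Eventually.of_forall fun ξ => ?_)
  rw [norm_mul]
  exact mul_le_of_le_one_left (norm_nonneg _) (hb ξ)

/-- Multiplication by a function of modulus at most one, as a linear map of `L²`. -/
def mulLinear (a : X → ℂ) (ha : AEStronglyMeasurable a μ) (hb : ∀ ξ, ‖a ξ‖ ≤ 1) :
    Lp ℂ 2 μ →ₗ[ℂ] Lp ℂ 2 μ where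
  toFun h := (memLp_mul_of_norm_le_one ha hb (Lp.memLp h)).toLp
  map_add' f g := by
    rw [← MemLp.toLp_add]
    refine MemLp.toLp_congr _ _ ?_
    filter_upwards [Lp.coeFn_add f g] with ξ h
    rw [h, Pi.add_apply, Pi.add_apply, mul_add]
  map_smul' c f := by
    rw [RingHom.id_apply, ← MemLp.toLp_const_smul]
    refine MemLp.toLp_congr _ _ ?_
    filter_upwards [Lp.coeFn_smul c f] with ξ h
    simp only [h, Pi.smul_apply, smul_eq_mul]
    ring

theorem coeFn_mulLinear (a : X → ℂ) (ha : AEStronglyMeasurable a μ) (hb : ∀ ξ, ‖a ξ‖ ≤ 1)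
    (h : Lp ℂ 2 μ) : mulLinear a ha hb h =ᵐ[μ] fun ξ => a ξ * h ξ :=
  MemLp.coeFn_toLp (memLp_mul_of_norm_le_one ha hb (Lp.memLp h))

theorem norm_mulLinear (a : X → ℂ) (ha : AEStronglyMeasurable a μ) (hb : ∀ ξ, ‖a ξ‖ ≤ 1)
    (h : Lp ℂ 2 μ) : ‖mulLinear a ha hb h‖ = (eLpNorm (fun ξ => a ξ * h ξ) 2 μ).toReal :=
  Lp.norm_toLp _ (memLp_mul_of_norm_le_one ha hb (Lp.memLp h))

/-- Multiplication by a function of modulus at most one, as a bounded operator on `L²`. -/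
def mulCLM (a : X → ℂ) (ha : AEStronglyMeasurable a μ) (hb : ∀ ξ, ‖a ξ‖ ≤ 1) :
    Lp ℂ 2 μ →L[ℂ] Lp ℂ 2 μ :=
  (mulLinear a ha hb).mkContinuous 1 fun h => by
    rw [one_mul, norm_mulLinear, Lp.norm_def]
    refine ENNReal.toReal_mono (Lp.memLp h).2.ne (eLpNorm_mono fun ξ => ?_)
    rw [norm_mul]
    exact mul_le_of_le_one_left (norm_nonneg _) (hb ξ)

theorem coeFn_mulCLM (a : X → ℂ) (ha : AEStronglyMeasurable a μ) (hb : ∀ ξ, ‖a ξ‖ ≤ 1)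
    (h : Lp ℂ 2 μ) : mulCLM a ha hb h =ᵐ[μ] fun ξ => a ξ * h ξ :=
  coeFn_mulLinear a ha hb h

theorem norm_mulCLM (a : X → ℂ) (ha : AEStronglyMeasurable a μ) (hb : ∀ ξ, ‖a ξ‖ ≤ 1)
    (h : Lp ℂ 2 μ) : ‖mulCLM a ha hb h‖ = (eLpNorm (fun ξ => a ξ * h ξ) 2 μ).toReal :=
  norm_mulLinear a ha hb h

end MulLp

variable {V : Type*} [NormedAddCommGroup V] [InnerProductSpace ℝ V]

/-- The character `ξ ↦ exp(-2πi x·ξ)`. -/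
def phase (x ξ : V) : ℂ := (Real.fourierChar (-inner ℝ ξ x) : ℂ)

theorem norm_phase (x ξ : V) : ‖phase x ξ‖ = 1 := Circle.norm_coe _

theorem continuous_phase (x : V) : Continuous (phase x) := by
  unfold phase
  exact continuous_subtype_val.comp (Real.continuous_fourierChar.comp (by fun_prop))

theorem phase_add (x y ξ : V) : phase (x + y) ξ = phase x ξ * phase y ξ := by
  simp only [phase, inner_add_right, neg_add, AddChar.map_add_eq_mul, Circle.coe_mul]

theorem phase_zero (ξ : V) : phase 0 ξ = 1 := by simp [phase]

variable [MeasurableSpace V] [BorelSpace V] [FiniteDimensional ℝ V]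

/-- Translation by `x`, on the Fourier side. -/
def modulation (x : V) : Lp ℂ 2 (volume : Measure V) →ₗᵢ[ℂ] Lp ℂ 2 (volume : Measure V) where
  toLinearMap := mulLinear (phase x) (continuous_phase x).aestronglyMeasurable
    fun ξ => (norm_phase x ξ).le
  norm_map' h := by
    rw [norm_mulLinear, Lp.norm_def]
    congr 1
    exact eLpNorm_congr_norm_ae (Eventually.of_forall fun ξ => by simp [norm_phase])

theorem coeFn_modulation (x : V) (h : Lp ℂ 2 (volume : Measure V)) :
    modulation x h =ᵐ[volume] fun ξ => phase x ξ * h ξ :=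
  coeFn_mulLinear (phase x) (continuous_phase x).aestronglyMeasurable
    (fun ξ => (norm_phase x ξ).le) h

theorem inner_modulation (x : V) (h k : Lp ℂ 2 (volume : Measure V)) :
    inner ℂ h (modulation x k) =
      ∫ ξ, Real.fourierChar (-inner ℝ ξ x) • (starRingEnd ℂ (h ξ) * k ξ) := by
  rw [L2.inner_def]
  refine integral_congr_ae ?_
  filter_upwards [coeFn_modulation x k] with ξ hξ
  rw [hξ, RCLike.inner_apply, Circle.smul_def, phase, smul_eq_mul]
  ring

theorem integrable_conj_mul (h k : Lp ℂ 2 (volume : Measure V)) :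
    Integrable (fun ξ => starRingEnd ℂ (h ξ) * k ξ) := by
  have := L2.integrable_inner (𝕜 := ℂ) h k
  simpa [RCLike.inner_apply, mul_comm] using this

/-- The coefficient `⟨h, U x k⟩` is the Fourier transform at `x` of the integrable function `conj h
* k`: it is continuous, and it vanishes at infinity by Riemann–Lebesgue. -/
theorem isDispersive_modulation : IsDispersive (modulation (V := V)) where
  map_zero h := by
    refine Lp.ext ?_
    filter_upwards [coeFn_modulation 0 h] with ξ hξ
    rw [hξ, phase_zero, one_mul]
  map_add x y h := by
    refine Lp.ext ?_
    filter_upwards [coeFn_modulation (x + y) h, coeFn_modulation x (modulation y h),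
      coeFn_modulation y h] with ξ h1 h2 h3
    rw [h1, h2, h3, phase_add, mul_assoc]
  continuous_inner h k := by
    simp only [inner_modulation]
    exact VectorFourier.fourierIntegral_continuous (L := innerₗ V) Real.continuous_fourierChar
      continuous_inner (integrable_conj_mul h k)
  tendsto_inner h k := by
    simp only [inner_modulation]
    exact tendsto_integral_exp_inner_smul_cocompact _

theorem mulCLM_modulation (a : V → ℂ) (ha : AEStronglyMeasurable a volume) (hb : ∀ ξ, ‖a ξ‖ ≤ 1)
    (x : V) (h : Lp ℂ 2 (volume : Measure V)) :
    mulCLM a ha hb (modulation x h) = modulation x (mulCLM a ha hb h) := by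
  refine Lp.ext ?_
  filter_upwards [coeFn_mulCLM a ha hb (modulation x h), coeFn_mulCLM a ha hb h,
    coeFn_modulation x h, coeFn_modulation x (mulCLM a ha hb h)] with ξ h1 h2 h3 h4
  rw [h1, h3, h4, h2]
  ring

end Multipliers

/-! ### Functions with a prescribed Fourier transform -/

noncomputable section Realization

variable {V : Type*} [NormedAddCommGroup V] [InnerProductSpace ℝ V] [MeasurableSpace V]
  [BorelSpace V] [FiniteDimensional ℝ V]

/-- The locally integrable function `f` has Fourier transform `g`, in the sense of tempered
distributions. -/
structure HasFourier (f g : V → ℂ) : Prop where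
  locallyIntegrable : LocallyIntegrable f
  integrable_left : ∀ φ : 𝓢(V, ℂ), Integrable fun x => f x * φ x
  integrable_right : ∀ φ : 𝓢(V, ℂ), Integrable fun ξ => g ξ * (𝓕⁻ φ : 𝓢(V, ℂ)) ξ
  integral_eq : ∀ φ : 𝓢(V, ℂ), ∫ x, f x * φ x = ∫ ξ, g ξ * (𝓕⁻ φ : 𝓢(V, ℂ)) ξ

namespace HasFourier

theorem congr {f f' g g' : V → ℂ} (h : HasFourier f g) (hf : f =ᵐ[volume] f')
    (hg : g =ᵐ[volume] g') : HasFourier f' g' where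
  locallyIntegrable := h.locallyIntegrable.congr hf
  integrable_left φ := (h.integrable_left φ).congr (hf.mono fun x hx => by simp only [hx])
  integrable_right φ := (h.integrable_right φ).congr (hg.mono fun x hx => by simp only [hx])
  integral_eq φ := by
    rw [← integral_congr_ae (hf.mono fun x hx => show f x * φ x = f' x * φ x by rw [hx]),
      h.integral_eq]
    exact integral_congr_ae (hg.mono fun x hx => by simp only [hx])

theorem add {f f' g g' : V → ℂ} (h : HasFourier f g) (h' : HasFourier f' g') :
    HasFourier (fun x => f x + f' x) (fun ξ => g ξ + g' ξ) where
  locallyIntegrable := h.locallyIntegrable.add h'.locallyIntegrable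
  integrable_left φ := by
    simpa only [add_mul] using! (h.integrable_left φ).add (h'.integrable_left φ)
  integrable_right φ := by
    simpa only [add_mul] using! (h.integrable_right φ).add (h'.integrable_right φ)
  integral_eq φ := by
    simp only [add_mul]
    rw [integral_add (h.integrable_left φ) (h'.integrable_left φ), h.integral_eq, h'.integral_eq,
      integral_add (h.integrable_right φ) (h'.integrable_right φ)]

theorem neg {f g : V → ℂ} (h : HasFourier f g) : HasFourier (fun x => -f x) (fun ξ => -g ξ) where
  locallyIntegrable := h.locallyIntegrable.neg
  integrable_left φ := by simpa only [neg_mul] using! (h.integrable_left φ).neg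
  integrable_right φ := by simpa only [neg_mul] using! (h.integrable_right φ).neg
  integral_eq φ := by simp only [neg_mul, integral_neg, h.integral_eq]

theorem sub {f f' g g' : V → ℂ} (h : HasFourier f g) (h' : HasFourier f' g') :
    HasFourier (fun x => f x - f' x) (fun ξ => g ξ - g' ξ) := by
  simpa only [sub_eq_add_neg] using h.add h'.neg

theorem fourierInv_compSubConst (φ : 𝓢(V, ℂ)) (x ξ : V) :
    (𝓕⁻ (φ.compSubConstCLM ℂ (-x)) : 𝓢(V, ℂ)) ξ = phase x ξ * (𝓕⁻ φ : 𝓢(V, ℂ)) ξ := by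
  simp only [SchwartzMap.fourierInv_coe, Real.fourierInv_eq]
  rw [← integral_sub_right_eq_self _ x, ← integral_const_mul]
  refine integral_congr_ae (Eventually.of_forall fun y => ?_)
  simp only [SchwartzMap.compSubConstCLM_apply, phase, Circle.smul_def, smul_eq_mul,
    inner_sub_left, sub_neg_eq_add, sub_add_cancel]
  rw [sub_eq_neg_add, AddChar.map_add_eq_mul, Circle.coe_mul, real_inner_comm ξ x, mul_assoc]

theorem translate {f g : V → ℂ} (h : HasFourier f g) (x : V) :
    HasFourier (fun y => f (y - x)) (fun ξ => phase x ξ * g ξ) := by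
  have h1 : ∀ φ : 𝓢(V, ℂ), (fun y => f (y - x) * φ y) =
      fun y => (fun z => f z * φ.compSubConstCLM ℂ (-x) z) (y - x) := fun φ => by
    funext y; simp
  have h2 : ∀ φ : 𝓢(V, ℂ), (fun ξ => phase x ξ * g ξ * (𝓕⁻ φ : 𝓢(V, ℂ)) ξ) =
      fun ξ => g ξ * (𝓕⁻ (φ.compSubConstCLM ℂ (-x)) : 𝓢(V, ℂ)) ξ := fun φ => by
    funext ξ; rw [fourierInv_compSubConst]; ring
  refine ⟨?_, fun φ => ?_, fun φ => ?_, fun φ => ?_⟩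
  · rw [locallyIntegrable_iff]
    intro K hK
    have h3 := (h.locallyIntegrable.integrableOn_isCompact (hK.image (continuous_sub_right x)))
    have h4 := (measurePreserving_sub_right (volume : Measure V) x).integrableOn_comp_preimage
      (Homeomorph.subRight x).measurableEmbedding (f := f) (s := (fun y => y - x) '' K)
    refine (h4.2 h3).mono_set (Set.subset_preimage_image _ _)
  · rw [h1]
    exact (h.integrable_left _).comp_sub_right x
  · rw [h2]
    exact h.integrable_right _
  · rw [h1, h2, integral_sub_right_eq_self (fun z => f z * φ.compSubConstCLM ℂ (-x) z),
      h.integral_eq]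

theorem unique {f f' g : V → ℂ} (h : HasFourier f g) (h' : HasFourier f' g) :
    f =ᵐ[volume] f' := by
  refine ae_eq_of_integral_contDiff_smul_eq h.locallyIntegrable h'.locallyIntegrable ?_
  intro ψ hψ hψ'
  have hc : HasCompactSupport (Complex.ofRealCLM ∘ ψ) := hψ'.comp_left rfl
  have hs : ContDiff ℝ (⊤ : ℕ∞) (Complex.ofRealCLM ∘ ψ) := by fun_prop
  have h1 := (h.integral_eq (hc.toSchwartzMap hs)).trans (h'.integral_eq (hc.toSchwartzMap hs)).symm
  simpa [mul_comm] using h1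

/-- Fubini, in the form of the self-adjointness of the Fourier integral. The pairing `-innerₗ V`
produces the sign of the inverse transform. -/
theorem of_integrable {g : V → ℂ} (hg : Integrable g) : HasFourier (𝓕⁻ g) g := by
  have hcont : Continuous (𝓕⁻ g) :=
    VectorFourier.fourierIntegral_continuous (L := -innerₗ V) Real.continuous_fourierChar
      (by simpa using! continuous_inner.neg) hg
  have hbound : ∀ x, ‖𝓕⁻ g x‖ ≤ ∫ ξ, ‖g ξ‖ := fun x =>
    VectorFourier.norm_fourierIntegral_le_integral_norm _ _ _ _ _
  refine ⟨hcont.locallyIntegrable, fun φ => ?_, fun φ => ?_, fun φ => ?_⟩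
  · exact (φ.integrable (μ := volume)).bdd_mul hcont.aestronglyMeasurable (Eventually.of_forall hbound)
  · exact hg.mul_bdd (𝓕⁻ φ : 𝓢(V, ℂ)).continuous.aestronglyMeasurable
      (Eventually.of_forall (𝓕⁻ φ : 𝓢(V, ℂ)).toBoundedContinuousFunction.norm_coe_le_norm)
  · have := VectorFourier.integral_fourierIntegral_smul_eq_flip (L := -innerₗ V)
      Real.continuous_fourierChar (by simpa using! continuous_inner.neg) hg
      (φ.integrable (μ := volume))
    rw [SchwartzMap.fourierInv_coe]
    have hflip : (-innerₗ V).flip = -innerₗ V := by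
      ext x y; simp [real_inner_comm]
    rw [hflip] at this
    exact this

/-- Plancherel. -/
theorem exists_of_memLp_two {g : V → ℂ} (hg : MemLp g 2) :
    ∃ f : V → ℂ, MemLp f 2 ∧ eLpNorm f 2 volume = eLpNorm g 2 volume ∧ HasFourier f g := by
  let G : Lp (α := V) ℂ 2 := hg.toLp
  let f : Lp (α := V) ℂ 2 := 𝓕⁻ G
  have hint : ∀ (k : Lp (α := V) ℂ 2) (φ : 𝓢(V, ℂ)), Integrable fun x => k x * φ x := fun k φ =>
    (Lp.memLp k).integrable_mul (φ.memLp 2)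
  have hf : HasFourier f G := by
    refine ⟨(Lp.memLp f).locallyIntegrable (by norm_num), hint f, fun φ => hint G _, fun φ => ?_⟩
    have h1 := congrArg (fun T => T φ) (Lp.fourierInv_toTemperedDistribution_eq G)
    simp only [TemperedDistribution.fourierInv_apply, Lp.toTemperedDistribution_apply,
      smul_eq_mul] at h1
    simp only [mul_comm _ (φ _), mul_comm (G _)]
    exact h1.symm
  refine ⟨f, Lp.memLp f, ?_, hf.congr ae_eq_rfl hg.coeFn_toLp⟩
  rw [← eLpNorm_congr_ae hg.coeFn_toLp, ← Lp.enorm_def, ← Lp.enorm_def]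
  have : ‖f‖ = ‖G‖ := (Lp.fourierTransformₗᵢ V ℂ).symm.norm_map G
  rw [← ofReal_norm, ← ofReal_norm, this]

end HasFourier

end Realization

/-! ### The Fourier transform and the homogeneous norms on `𝓢₀'` -/

noncomputable section HomogeneousNorm

variable {d : ℕ}

theorem fourier_fourier_apply (ψ : 𝓢(EuclideanSpace ℝ (Fin d), ℂ)) (x : EuclideanSpace ℝ (Fin d)) :
    (𝓕 (𝓕 ψ) : 𝓢(EuclideanSpace ℝ (Fin d), ℂ)) x = ψ (-x) := by
  have h : (𝓕⁻ (𝓕 ψ) : 𝓢(EuclideanSpace ℝ (Fin d), ℂ)) (-x) = ψ (-x) := by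
    rw [FourierPair.fourierInv_fourier_eq]
  rw [← h, SchwartzMap.fourierInv_apply_eq]
  simp

/-- Since `𝓕 (𝓕 ψ)` is the reflection of `ψ`, it vanishes near the origin with all its derivatives.
This supplies enough test functions in `𝓢₀`. -/
theorem fourier_mem_schwartzZero {ψ : 𝓢(EuclideanSpace ℝ (Fin d), ℂ)}
    (hψ : (0 : EuclideanSpace ℝ (Fin d)) ∉ tsupport ψ) : 𝓕 ψ ∈ SchwartzZero d := by
  intro k
  have h1 : ∀ᶠ x in 𝓝 (0 : EuclideanSpace ℝ (Fin d)), ψ (-x) = 0 := by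
    have h2 : Tendsto (fun x : EuclideanSpace ℝ (Fin d) => -x) (𝓝 0) (𝓝 0) := by
      simpa using (continuous_neg (G := EuclideanSpace ℝ (Fin d))).tendsto 0
    exact h2.eventually (notMem_tsupport_iff_eventuallyEq.1 hψ)
  have h3 : ((𝓕 (𝓕 ψ) : 𝓢(EuclideanSpace ℝ (Fin d), ℂ)) : EuclideanSpace ℝ (Fin d) → ℂ)
      =ᶠ[𝓝 0] fun _ => 0 := h1.mono fun x hx => by rw [fourier_fourier_apply, hx]
  rw [(h3.iteratedFDeriv ℝ k).eq_of_nhds]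
  simp [iteratedFDeriv_fun_zero]

theorem IsFourierFunction.congr {u : SchwartzZero d → ℂ} {g g' : EuclideanSpace ℝ (Fin d) → ℂ}
    (h : IsFourierFunction u g) (hg : g =ᵐ[volume] g') : IsFourierFunction u g' := by
  refine ⟨h.1.congr hg, fun φ => ⟨((h.2 φ).1).congr ?_, (h.2 φ).2.trans (integral_congr_ae ?_)⟩⟩ <;>
  exact hg.mono fun x hx => by simp only [hx]

/-- Testing `u` on `𝓕 ψ` isolates `g` away from the origin. The element `φ` is returned with its
inverse transform so that a second Fourier function of `u` can be evaluated on the same `φ`. -/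
theorem IsFourierFunction.integral_smul {u : SchwartzZero d → ℂ}
    {g : EuclideanSpace ℝ (Fin d) → ℂ} (h : IsFourierFunction u g)
    {ψ : EuclideanSpace ℝ (Fin d) → ℝ} (hs : ContDiff ℝ (⊤ : ℕ∞) ψ) (hc : HasCompactSupport ψ)
    (h0 : tsupport ψ ⊆ {0}ᶜ) :
    Integrable (fun ξ => ψ ξ • g ξ) ∧
      ∃ φ : SchwartzZero d, ∫ ξ, ψ ξ • g ξ = u φ ∧ ∀ ξ,
        (𝓕⁻ (φ : 𝓢(EuclideanSpace ℝ (Fin d), ℂ)) : 𝓢(EuclideanSpace ℝ (Fin d), ℂ)) ξ = ψ ξ := by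
  have hc' : HasCompactSupport (Complex.ofRealCLM ∘ ψ) := hc.comp_left rfl
  have hs' : ContDiff ℝ (⊤ : ℕ∞) (Complex.ofRealCLM ∘ ψ) := by fun_prop
  let Ψ := hc'.toSchwartzMap hs'
  have hΨ : ∀ ξ, Ψ ξ = ψ ξ := fun ξ => rfl
  have hmem : 𝓕 Ψ ∈ SchwartzZero d := fourier_mem_schwartzZero fun hm =>
    h0 (tsupport_comp_subset (g := Complex.ofRealCLM) (map_zero _) ψ hm) rfl
  have h1 := h.2 ⟨𝓕 Ψ, hmem⟩
  simp only [FourierPair.fourierInv_fourier_eq, hΨ, mul_comm (g _)] at h1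
  refine ⟨by simpa only [Complex.real_smul] using h1.1, ⟨𝓕 Ψ, hmem⟩, ?_, ?_⟩
  · simpa only [Complex.real_smul] using h1.2.symm
  · intro ξ
    rw [FourierPair.fourierInv_fourier_eq, hΨ]

theorem IsFourierFunction.locallyIntegrableOn {u : SchwartzZero d → ℂ}
    {g : EuclideanSpace ℝ (Fin d) → ℂ} (h : IsFourierFunction u g) :
    LocallyIntegrableOn g {0}ᶜ := by
  intro x hx
  obtain ⟨ψ, hψ, hc, hs, -, h1⟩ := exists_contDiff_tsupport_subset
    (n := (⊤ : ℕ∞)) (isOpen_compl_singleton.mem_nhds hx)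
  have hS : IsOpen {ξ | 1 / 2 < ψ ξ} := isOpen_lt continuous_const hs.continuous
  -- On this set `|g| ≤ 2 |ψ g|`, and `ψ g` is integrable.
  refine ⟨{ξ | 1 / 2 < ψ ξ}, mem_nhdsWithin_of_mem_nhds (hS.mem_nhds ?_), ?_⟩
  · change 1 / 2 < ψ x; rw [h1]; norm_num
  · refine (((h.integral_smul hs hc hψ).1.norm.const_mul 2).integrableOn).mono' h.1.restrict ?_
    filter_upwards [ae_restrict_mem hS.measurableSet] with ξ hξ
    rw [norm_smul, Real.norm_eq_abs]
    have h2 : 1 / 2 < ψ ξ := hξ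
    have h3 : 1 ≤ 2 * |ψ ξ| := by linarith [le_abs_self (ψ ξ)]
    nlinarith [norm_nonneg (g ξ)]

/-- Elements of `𝓢₀` determine `g` only off the origin, a null set because `d ≥ 1`. -/
theorem IsFourierFunction.unique (hd : 1 ≤ d) {u : SchwartzZero d → ℂ}
    {g g' : EuclideanSpace ℝ (Fin d) → ℂ} (h : IsFourierFunction u g)
    (h' : IsFourierFunction u g') : g =ᵐ[volume] g' := by
  have : Nonempty (Fin d) := ⟨⟨0, hd⟩⟩
  have h1 := isOpen_compl_singleton.ae_eq_zero_of_integral_contDiff_smul_eq_zero (μ := volume)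
    (f := fun ξ => g ξ - g' ξ) (h.locallyIntegrableOn.sub h'.locallyIntegrableOn) (by
      intro ψ hs hc h0
      simp only [smul_sub]
      obtain ⟨i1, φ, e1, hφ⟩ := h.integral_smul hs hc h0
      obtain ⟨i2, -⟩ := h'.integral_smul hs hc h0
      rw [integral_sub i1 i2, e1, (h'.2 φ).2]
      simp only [hφ, Complex.real_smul, mul_comm (g' _), sub_self])
  filter_upwards [h1, Measure.ae_ne volume (0 : EuclideanSpace ℝ (Fin d))] with ξ h2 h3
  exact sub_eq_zero.1 (h2 h3)

theorem hdotENorm_eq (hd : 1 ≤ d) (γ : ℝ) {u : SchwartzZero d → ℂ}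
    {g : EuclideanSpace ℝ (Fin d) → ℂ} (h : IsFourierFunction u g) :
    hdotENorm γ u = eLpNorm (fun ξ => (((2 * Real.pi * ‖ξ‖) ^ γ : ℝ) : ℂ) * g ξ) 2 volume := by
  refine le_antisymm (iInf₂_le g h) (le_iInf₂ fun g' h' => le_of_eq ?_)
  exact eLpNorm_congr_ae ((h.unique hd h').mono fun ξ hξ => by simp only [hξ])

theorem exists_isFourierFunction_of_hdotENorm_lt_top {γ : ℝ} {u : SchwartzZero d → ℂ}
    (h : hdotENorm γ u < ⊤) : ∃ g, IsFourierFunction u g := by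
  simp only [hdotENorm, iInf_lt_iff] at h
  obtain ⟨g, hg, -⟩ := h
  exact ⟨g, hg⟩

theorem HasFourier.isFourierFunction {f g : EuclideanSpace ℝ (Fin d) → ℂ} (h : HasFourier f g)
    (hg : AEStronglyMeasurable g volume) : IsFourierFunction (pairing f) g :=
  ⟨hg, fun φ => ⟨h.integrable_right φ, h.integral_eq φ⟩⟩

end HomogeneousNorm

/-! ### Square integrability of `|ξ|^(-s)` near the origin -/

noncomputable section Sobolev

set_option linter.unusedSectionVars false

variable {V : Type*} [NormedAddCommGroup V] [InnerProductSpace ℝ V] [MeasurableSpace V]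
  [BorelSpace V] [FiniteDimensional ℝ V]

/-- The symbol `2π|ξ|` of `|∇|`. -/
def freq (ξ : V) : ℝ := 2 * Real.pi * ‖ξ‖

theorem freq_nonneg (ξ : V) : 0 ≤ freq ξ := by unfold freq; positivity

theorem freq_pos {ξ : V} (h : ξ ≠ 0) : 0 < freq ξ := by
  have := norm_pos_iff.2 h
  unfold freq; positivity

theorem norm_le_freq (ξ : V) : ‖ξ‖ ≤ freq ξ := by
  unfold freq
  nlinarith [norm_nonneg ξ, Real.pi_gt_three]

theorem measurable_freq : Measurable (freq (V := V)) := by unfold freq; fun_prop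

theorem exists_eLpNorm_ball_freq_rpow_le [Nontrivial V] {s : ℝ} (hs0 : 0 ≤ s)
    (hs : s < (Module.finrank ℝ V : ℝ) / 2) :
    ∃ K : ℝ, 0 < K ∧ ∀ R : ℝ, 0 < R →
      eLpNorm ((Metric.ball (0 : V) R).indicator fun ξ => ((freq ξ ^ (-s) : ℝ) : ℂ)) 2 volume ≤
        ENNReal.ofReal (K * R ^ ((Module.finrank ℝ V : ℝ) / 2 - s)) := by
  set n := Module.finrank ℝ V with hn
  have hn0 : 0 < n := Module.finrank_pos
  -- The constant from polar coordinates, where `∫₀^R y^(n-1-2s) dy = R^(n-2s) / (n-2s)`; adding one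
  -- makes it evidently positive.
  let c : ℝ := n * (volume.real (Metric.ball (0 : V) 1)) / (n - 2 * s) + 1
  have hc : 0 < c := by
    have : 0 < (n : ℝ) - 2 * s := by linarith
    positivity
  refine ⟨√c, Real.sqrt_pos.2 hc, fun R hR => ?_⟩
  have hF : ∀ y : ℝ, y ∈ Set.Ioi 0 → y ^ (n - 1) • (Set.Iio R).indicator (fun y => y ^ (-(2 * s))) y =
      (Set.Iio R).indicator (fun y => y ^ ((n : ℝ) - 1 - 2 * s)) y := by
    intro y hy
    have hy : 0 < y := hy
    by_cases h : y ∈ Set.Iio R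
    · rw [Set.indicator_of_mem h, Set.indicator_of_mem h, smul_eq_mul, ← Real.rpow_natCast,
        ← Real.rpow_add hy, Nat.cast_sub hn0]
      congr 1; push_cast; ring
    · simp [Set.indicator_of_notMem h]
  have hI : IntegrableOn (fun y : ℝ => y ^ ((n : ℝ) - 1 - 2 * s)) (Set.Ioo 0 R) := by
    rw [← integrableOn_Ioc_iff_integrableOn_Ioo, ← intervalIntegrable_iff_integrableOn_Ioc_of_le hR.le]
    exact intervalIntegral.intervalIntegrable_rpow' (by linarith)
  have hval : ∫ y in Set.Ioo 0 R, y ^ ((n : ℝ) - 1 - 2 * s) = R ^ ((n : ℝ) - 2 * s) / (n - 2 * s) := by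
    rw [← integral_Ioc_eq_integral_Ioo, ← intervalIntegral.integral_of_le hR.le,
      integral_rpow (Or.inl (by linarith))]
    rw [Real.zero_rpow (by linarith)]
    ring_nf
  have hint : Integrable (fun ξ : V => (Set.Iio R).indicator (fun y => y ^ (-(2 * s))) ‖ξ‖) := by
    rw [integrable_fun_norm_addHaar volume (f := (Set.Iio R).indicator fun y => y ^ (-(2 * s)))]
    rw [integrableOn_congr_fun hF measurableSet_Ioi]
    rw [integrableOn_indicator_iff measurableSet_Iio]
    rwa [Set.Iio_inter_Ioi]
  have hint2 : ∫ ξ : V, (Set.Iio R).indicator (fun y => y ^ (-(2 * s))) ‖ξ‖ ≤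
      c * R ^ ((n : ℝ) - 2 * s) := by
    rw [integral_fun_norm_addHaar volume ((Set.Iio R).indicator fun y => y ^ (-(2 * s))),
      setIntegral_congr_fun measurableSet_Ioi hF, setIntegral_indicator measurableSet_Iio,
      Set.Ioi_inter_Iio, hval, nsmul_eq_mul, smul_eq_mul]
    have : 0 ≤ R ^ ((n : ℝ) - 2 * s) := by positivity
    calc _ = (c - 1) * R ^ ((n : ℝ) - 2 * s) := by simp only [c, hn]; ring
      _ ≤ _ := by nlinarith
  have hle : ∫⁻ ξ : V, ‖(Metric.ball (0 : V) R).indicator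
      (fun ξ => ((freq ξ ^ (-s) : ℝ) : ℂ)) ξ‖ₑ ^ (2 : ℝ) ≤
      ENNReal.ofReal (c * R ^ ((n : ℝ) - 2 * s)) := by
    refine le_trans ?_ (ENNReal.ofReal_le_ofReal hint2)
    rw [ofReal_integral_eq_lintegral_ofReal hint
      (Eventually.of_forall fun ξ => Set.indicator_apply_nonneg fun _ => by positivity)]
    refine lintegral_mono_ae ?_
    filter_upwards [Measure.ae_ne volume (0 : V)] with ξ hξ
    by_cases h : ‖ξ‖ < R
    · rw [Set.indicator_of_mem (by simpa using h), Set.indicator_of_mem (by simpa using h),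
        ← ofReal_norm, ENNReal.ofReal_rpow_of_nonneg (norm_nonneg _) (by norm_num)]
      refine ENNReal.ofReal_le_ofReal ?_
      have h1 := norm_pos_iff.2 hξ
      rw [Complex.norm_real, Real.norm_of_nonneg (by have := freq_nonneg ξ; positivity),
        ← Real.rpow_mul (freq_nonneg ξ), show -s * 2 = -(2 * s) by ring]
      exact Real.rpow_le_rpow_of_nonpos h1 (norm_le_freq ξ) (by linarith)
    · rw [Set.indicator_of_notMem (by simpa using h)]
      simp
  rw [eLpNorm_eq_lintegral_rpow_enorm_toReal (by norm_num) (by norm_num)]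
  simp only [ENNReal.toReal_ofNat]
  refine (ENNReal.rpow_le_rpow hle (by norm_num)).trans (le_of_eq ?_)
  rw [ENNReal.ofReal_rpow_of_nonneg (by positivity) (by norm_num), ← Real.sqrt_eq_rpow,
    Real.sqrt_mul hc.le, Real.sqrt_eq_rpow (R ^ _), ← Real.rpow_mul hR.le]
  congr 3; ring

theorem indicator_add_indicator_compl (A : Set V) (g : V → ℂ) (ξ : V) :
    A.indicator g ξ + Aᶜ.indicator g ξ = g ξ := by
  by_cases h : ξ ∈ A <;> simp [h]

end Sobolev

/-! ### The homogeneous Sobolev embedding -/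

noncomputable section SobolevEmbedding

set_option linter.unusedSectionVars false

variable {V : Type*} [NormedAddCommGroup V] [InnerProductSpace ℝ V] [MeasurableSpace V]
  [BorelSpace V] [FiniteDimensional ℝ V]

/-- A function with `|ξ|^s g ∈ L²`, `0 ≤ s < n/2`, is integrable at low frequencies and square
integrable at high frequencies. -/
theorem exists_frequency_splitting [Nontrivial V] {s : ℝ} (hs0 : 0 ≤ s)
    (hs : s < (Module.finrank ℝ V : ℝ) / 2) :
    ∃ K : ℝ, 0 < K ∧ ∀ (g : V → ℂ) (N R : ℝ), 0 < R → 0 ≤ N → AEStronglyMeasurable g volume →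
      eLpNorm (fun ξ => ((freq ξ ^ s : ℝ) : ℂ) * g ξ) 2 volume ≤ ENNReal.ofReal N →
      ∃ f₁ f₂ : V → ℂ, (∀ x, ‖f₁ x‖ ≤ K * R ^ ((Module.finrank ℝ V : ℝ) / 2 - s) * N) ∧
        MemLp f₂ 2 volume ∧
        eLpNorm f₂ 2 volume = eLpNorm ((Metric.ball (0 : V) R)ᶜ.indicator g) 2 volume ∧
        HasFourier (fun x => f₁ x + f₂ x) g := by
  obtain ⟨K, hK, hKR⟩ := exists_eLpNorm_ball_freq_rpow_le hs0 hs
  refine ⟨K, hK, fun g N R hR hN hg hgN => ?_⟩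
  -- Cauchy–Schwarz between `|∇|^(-s)` cut off to the ball and `|∇|^s g`, on the level of symbols.
  have hlow : eLpNorm ((Metric.ball (0 : V) R).indicator g) 1 volume ≤
      ENNReal.ofReal (K * R ^ ((Module.finrank ℝ V : ℝ) / 2 - s) * N) := by
    have h1 : (Metric.ball (0 : V) R).indicator g =ᵐ[volume]
        ((Metric.ball (0 : V) R).indicator fun ξ => ((freq ξ ^ (-s) : ℝ) : ℂ)) •
          (fun ξ => ((freq ξ ^ s : ℝ) : ℂ) * g ξ) := by
      filter_upwards [Measure.ae_ne volume (0 : V)] with ξ hξ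
      by_cases h : ξ ∈ Metric.ball (0 : V) R
      · rw [Pi.smul_apply', Set.indicator_of_mem h, Set.indicator_of_mem h, smul_eq_mul,
          ← mul_assoc, ← Complex.ofReal_mul, ← Real.rpow_add (freq_pos hξ), neg_add_cancel,
          Real.rpow_zero, Complex.ofReal_one, one_mul]
      · rw [Pi.smul_apply', Set.indicator_of_notMem h, Set.indicator_of_notMem h, zero_smul]
    have hm : Measurable fun ξ : V => ((freq ξ ^ s : ℝ) : ℂ) :=
      Complex.measurable_ofReal.comp (measurable_freq.pow_const _)
    have hm' : Measurable fun ξ : V => ((freq ξ ^ (-s) : ℝ) : ℂ) :=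
      Complex.measurable_ofReal.comp (measurable_freq.pow_const _)
    rw [eLpNorm_congr_ae h1]
    refine (eLpNorm_smul_le_mul_eLpNorm (p := 2) (q := 2) (hm.aestronglyMeasurable.mul hg)
      (hm'.indicator measurableSet_ball).aestronglyMeasurable).trans ?_
    rw [ENNReal.ofReal_mul (by positivity)]
    exact mul_le_mul' (hKR R hR) hgN
  have hlow1 : Integrable ((Metric.ball (0 : V) R).indicator g) :=
    memLp_one_iff_integrable.1 ⟨hg.indicator measurableSet_ball, hlow.trans_lt ENNReal.ofReal_lt_top⟩
  have hhigh : MemLp ((Metric.ball (0 : V) R)ᶜ.indicator g) 2 volume := by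
    have h1 : MemLp (fun ξ => ((freq ξ ^ s : ℝ) : ℂ) * g ξ) 2 (volume : Measure V) :=
      ⟨(Complex.measurable_ofReal.comp (measurable_freq.pow_const _)).aestronglyMeasurable.mul hg,
        hgN.trans_lt ENNReal.ofReal_lt_top⟩
    refine h1.of_le_mul (c := R ^ (-s)) (hg.indicator measurableSet_ball.compl)
      (Eventually.of_forall fun ξ => ?_)
    by_cases h : ξ ∈ (Metric.ball (0 : V) R)ᶜ
    · rw [Set.indicator_of_mem h, norm_mul, ← mul_assoc]
      refine le_mul_of_one_le_left (norm_nonneg _) ?_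
      have h2 : R ≤ ‖ξ‖ := by simpa using h
      have h3 : R ≤ freq ξ := h2.trans (norm_le_freq ξ)
      rw [Complex.norm_real, Real.norm_of_nonneg (Real.rpow_nonneg (freq_nonneg ξ) _),
        Real.rpow_neg hR.le, inv_mul_eq_div, one_le_div (by positivity)]
      exact Real.rpow_le_rpow hR.le h3 hs0
    · rw [Set.indicator_of_notMem h, norm_zero]
      positivity
  obtain ⟨f₂, hf₂, hf₂', hF₂⟩ := HasFourier.exists_of_memLp_two hhigh
  refine ⟨𝓕⁻ ((Metric.ball (0 : V) R).indicator g), f₂, fun x => ?_, hf₂, hf₂', ?_⟩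
  · refine (VectorFourier.norm_fourierIntegral_le_integral_norm _ _ _ _ _).trans ?_
    rw [integral_norm_eq_lintegral_enorm hlow1.1]
    rw [eLpNorm_one_eq_lintegral_enorm] at hlow
    exact ENNReal.toReal_le_of_le_ofReal (by positivity) hlow
  · refine ((HasFourier.of_integrable hlow1).add hF₂).congr ae_eq_rfl
      (Eventually.of_forall fun ξ => ?_)
    exact indicator_add_indicator_compl _ _ _

theorem lintegral_enorm_sq {X : Type*} [MeasurableSpace X] {μ : Measure X} (u : X → ℂ) :
    ∫⁻ x, ‖u x‖ₑ ^ 2 ∂μ = eLpNorm u 2 μ ^ 2 := by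
  rw [eLpNorm_eq_lintegral_rpow_enorm_toReal (by norm_num) (by norm_num)]
  simp only [ENNReal.toReal_ofNat, ENNReal.rpow_ofNat]
  rw [← ENNReal.rpow_natCast, ← ENNReal.rpow_mul]
  norm_num

/-- Where the sum exceeds `t`, the part `f₂` is at least `t / 2`; then Chebyshev. -/
theorem measure_lt_norm_add_le {X : Type*} [MeasurableSpace X] {μ : Measure X} {f₁ f₂ : X → ℂ}
    {t : ℝ} (ht : 0 < t) (h₁ : ∀ x, ‖f₁ x‖ ≤ t / 2) (h₂ : AEStronglyMeasurable f₂ μ) :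
    μ {x | t < ‖f₁ x + f₂ x‖} ≤ ENNReal.ofReal (4 / t ^ 2) * ∫⁻ x, ‖f₂ x‖ₑ ^ 2 ∂μ := by
  have h3 : {x | t < ‖f₁ x + f₂ x‖} ⊆ {x | ENNReal.ofReal (t ^ 2 / 4) ≤ ‖f₂ x‖ₑ ^ 2} := by
    intro x hx
    have hx : t < ‖f₁ x + f₂ x‖ := hx
    have h4 : t / 2 ≤ ‖f₂ x‖ := by linarith [norm_add_le (f₁ x) (f₂ x), h₁ x]
    change ENNReal.ofReal (t ^ 2 / 4) ≤ ‖f₂ x‖ₑ ^ 2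
    rw [← ofReal_norm, ← ENNReal.ofReal_pow (norm_nonneg _)]
    refine ENNReal.ofReal_le_ofReal ?_
    nlinarith
  have h5 := mul_meas_ge_le_lintegral₀ (h₂.enorm.pow_const 2) (ENNReal.ofReal (t ^ 2 / 4))
  have h6 : ENNReal.ofReal (4 / t ^ 2) * ENNReal.ofReal (t ^ 2 / 4) = 1 := by
    rw [← ENNReal.ofReal_mul (by positivity), ENNReal.ofReal_eq_one]
    field_simp
  calc μ {x | t < ‖f₁ x + f₂ x‖} ≤ μ {x | ENNReal.ofReal (t ^ 2 / 4) ≤ ‖f₂ x‖ₑ ^ 2} :=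
        measure_mono h3
    _ = ENNReal.ofReal (4 / t ^ 2) * (ENNReal.ofReal (t ^ 2 / 4) *
          μ {x | ENNReal.ofReal (t ^ 2 / 4) ≤ ‖f₂ x‖ₑ ^ 2}) := by rw [← mul_assoc, h6, one_mul]
    _ ≤ _ := by gcongr

theorem lintegral_Ioi_indicator_rpow {a L : ℝ} (ha : -1 < a) (hL : 0 ≤ L) :
    ∫⁻ t in Set.Ioi (0 : ℝ), (Set.Iic L).indicator (fun t => ENNReal.ofReal (t ^ a)) t =
      ENNReal.ofReal (L ^ (a + 1) / (a + 1)) := by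
  rw [lintegral_indicator measurableSet_Iic, Measure.restrict_restrict measurableSet_Iic,
    Set.Iic_inter_Ioi]
  rw [← ofReal_integral_eq_lintegral_ofReal, ← intervalIntegral.integral_of_le hL,
    integral_rpow (Or.inl ha), Real.zero_rpow (by linarith), sub_zero]
  · rw [← IntegrableOn, ← intervalIntegrable_iff_integrableOn_Ioc_of_le hL]
    exact intervalIntegral.intervalIntegrable_rpow' ha
  · filter_upwards [ae_restrict_mem measurableSet_Ioc] with t ht
    exact Real.rpow_nonneg ht.1.le _

/-- The Sobolev embedding of the homogeneous space `Ḣ^s` into `L^p`, `p = 2n / (n - 2s)`. -/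
theorem exists_eLpNorm_le_of_hasFourier [Nontrivial V] {s : ℝ} (hs0 : 0 < s)
    (hs : s < (Module.finrank ℝ V : ℝ) / 2) :
    ∃ C : ℝ, 0 < C ∧ ∀ (f g : V → ℂ) (N : ℝ), 0 < N → AEStronglyMeasurable g volume →
      HasFourier f g →
      eLpNorm (fun ξ => ((freq ξ ^ s : ℝ) : ℂ) * g ξ) 2 volume ≤ ENNReal.ofReal N →
      eLpNorm f (ENNReal.ofReal (2 * (Module.finrank ℝ V : ℝ) /
        ((Module.finrank ℝ V : ℝ) - 2 * s))) volume ≤ ENNReal.ofReal (C * N) := by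
  obtain ⟨K, hK, hsplit⟩ := exists_frequency_splitting hs0.le hs
  set n : ℝ := (Module.finrank ℝ V : ℝ) with hn
  set p : ℝ := 2 * n / (n - 2 * s) with hp
  set b : ℝ := n / 2 - s with hb
  have hb0 : 0 < b := by rw [hb]; linarith
  have hn2s : 0 < n - 2 * s := by linarith
  -- The exponent `p` is the one for which `b (p - 2) = 2 s`, so that integrating over the levels
  -- `t` below reproduces exactly `|ξ|^(2s)`.
  have hp2 : p - 2 = 2 * s / b := by rw [hp, hb]; field_simp; ring
  have hp2' : 0 < p - 2 := by rw [hp2]; positivity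
  have hp0 : 0 < p := by linarith
  let D : ℝ := p * (4 * ((2 * K) ^ (p - 2) / (p - 2)))
  have hD : 0 < D := by positivity
  refine ⟨D ^ (1 / p), by positivity, fun f g N hN hg hfg hgN => ?_⟩
  let A : ℝ := 2 * K * N
  have hA : 0 < A := by positivity
  have hfm : AEStronglyMeasurable f volume := hfg.locallyIntegrable.aestronglyMeasurable
  have hdist : ∀ t : ℝ, 0 < t → volume {x | t < ‖f x‖} ≤ ENNReal.ofReal (4 / t ^ 2) *
      ∫⁻ ξ, {ξ : V | t ≤ A * ‖ξ‖ ^ b}.indicator (fun ξ => ‖g ξ‖ₑ ^ 2) ξ := by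
    intro t ht
    -- The frequency cutoff depends on the level `t`: it is chosen so that `K R^b N = t / 2`, and
    -- only high frequencies contribute to the level set.
    let R : ℝ := (t / A) ^ (1 / b)
    have hR : 0 < R := by positivity
    have hRb : R ^ b = t / A := by
      rw [← Real.rpow_mul (by positivity), one_div_mul_cancel hb0.ne', Real.rpow_one]
    obtain ⟨f₁, f₂, h1, h2, h3, h4⟩ := hsplit g N R hR hN.le hg hgN
    have h5 : f =ᵐ[volume] fun x => f₁ x + f₂ x := hfg.unique h4
    have h6 : volume {x | t < ‖f x‖} = volume {x | t < ‖f₁ x + f₂ x‖} :=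
      measure_congr (h5.mono fun x hx => by
        change (t < ‖f x‖) = (t < ‖f₁ x + f₂ x‖)
        rw [hx])
    rw [h6]
    refine (measure_lt_norm_add_le ht (fun x => (h1 x).trans (le_of_eq ?_)) h2.1).trans ?_
    · rw [hRb]; simp only [A]; field_simp
    · refine mul_le_mul' le_rfl ?_
      rw [lintegral_enorm_sq, h3, ← lintegral_enorm_sq]
      refine lintegral_mono fun ξ => ?_
      by_cases h : ξ ∈ (Metric.ball (0 : V) R)ᶜ
      · have h8 : R ≤ ‖ξ‖ := by simpa using h
        have h9 : t ≤ A * ‖ξ‖ ^ b := by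
          rw [← div_le_iff₀' hA, ← hRb]
          exact Real.rpow_le_rpow hR.le h8 hb0.le
        rw [Set.indicator_of_mem h, Set.indicator_of_mem (by exact h9)]
      · rw [Set.indicator_of_notMem h]
        simp
  have hmain : ∫⁻ x, ‖f x‖ₑ ^ p ≤ ENNReal.ofReal (D * N ^ p) := by
    -- The integrand of the layer-cake formula, up to the factor `p`, after inserting the level set
    -- bound. Tonelli lets the `t`-integral be done first, over `0 < t ≤ A |ξ|^b`.
    let F : ℝ → V → ℝ≥0∞ := fun t ξ => ENNReal.ofReal 4 * ‖g ξ‖ₑ ^ 2 *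
      (Set.Iic (A * ‖ξ‖ ^ b)).indicator (fun t => ENNReal.ofReal (t ^ (p - 3))) t
    have hF1 : ∀ t : ℝ, 0 < t →
        volume {x | t < ‖f x‖} * ENNReal.ofReal (t ^ (p - 1)) ≤ ∫⁻ ξ, F t ξ := by
      intro t ht
      refine (mul_le_mul_left (hdist t ht) _).trans (le_of_eq ?_)
      rw [mul_right_comm, ← ENNReal.ofReal_mul (by positivity),
        ← lintegral_const_mul' _ _ ENNReal.ofReal_ne_top]
      refine lintegral_congr fun ξ => ?_
      have hpow : 4 / t ^ 2 * t ^ (p - 1) = 4 * t ^ (p - 3) := by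
        rw [show p - 1 = (p - 3) + (2 : ℕ) by push_cast; ring, Real.rpow_add_natCast ht.ne']
        field_simp
      simp only [F]
      by_cases h : t ≤ A * ‖ξ‖ ^ b
      · rw [Set.indicator_of_mem (by exact h), Set.indicator_of_mem (by exact h), hpow,
          ENNReal.ofReal_mul (by norm_num)]
        ring
      · rw [Set.indicator_of_notMem (by exact h), Set.indicator_of_notMem (by exact h)]
        simp
    have hF2 : AEMeasurable (Function.uncurry F)
        ((volume.restrict (Set.Ioi (0 : ℝ))).prod (volume : Measure V)) := by
      have h1 : AEMeasurable (fun q : ℝ × V => ‖g q.2‖ₑ)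
          ((volume.restrict (Set.Ioi (0 : ℝ))).prod (volume : Measure V)) :=
        hg.enorm.comp_snd
      have h2 : MeasurableSet {q : ℝ × V | q.1 ≤ A * ‖q.2‖ ^ b} :=
        measurableSet_le measurable_fst
          ((measurable_snd.norm.pow_const b).const_mul A)
      have h3 : Measurable fun q : ℝ × V => ENNReal.ofReal (q.1 ^ (p - 3)) :=
        (measurable_fst.pow_const _).ennreal_ofReal
      exact ((h1.pow_const 2).const_mul _).mul (h3.indicator h2).aemeasurable
    have hF3 : ∀ ξ, ∫⁻ t in Set.Ioi (0 : ℝ), F t ξ ≤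
        ENNReal.ofReal (4 * (A ^ (p - 2) / (p - 2))) * ‖((freq ξ ^ s : ℝ) : ℂ) * g ξ‖ₑ ^ 2 := by
      intro ξ
      have hL : 0 ≤ A * ‖ξ‖ ^ b := by positivity
      simp only [F]
      rw [lintegral_const_mul' _ _ (by finiteness),
        lintegral_Ioi_indicator_rpow (by linarith) hL, enorm_mul, mul_pow,
        ← ofReal_norm ((freq ξ ^ s : ℝ) : ℂ), Complex.norm_real,
        Real.norm_of_nonneg (Real.rpow_nonneg (freq_nonneg ξ) _),
        ← ENNReal.ofReal_pow (Real.rpow_nonneg (freq_nonneg ξ) _), mul_right_comm,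
        ← ENNReal.ofReal_mul (by norm_num), ← mul_assoc, ← ENNReal.ofReal_mul (by positivity)]
      refine mul_le_mul_left (ENNReal.ofReal_le_ofReal ?_) _
      rw [show p - 3 + 1 = p - 2 by ring, Real.mul_rpow hA.le (by positivity),
        ← Real.rpow_mul (norm_nonneg _), show b * (p - 2) = s * (2 : ℕ) by
          rw [hp2]; push_cast; field_simp, Real.rpow_mul_natCast (norm_nonneg _)]
      have h1 : ‖ξ‖ ^ s ≤ freq ξ ^ s := Real.rpow_le_rpow (norm_nonneg _) (norm_le_freq ξ) hs0.le
      rw [mul_div_right_comm, ← mul_assoc]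
      gcongr
    calc ∫⁻ x, ‖f x‖ₑ ^ p = ∫⁻ x, ENNReal.ofReal (‖f x‖ ^ p) := by
          refine lintegral_congr fun x => ?_
          rw [← ofReal_norm, ENNReal.ofReal_rpow_of_nonneg (norm_nonneg _) hp0.le]
      _ = ENNReal.ofReal p * ∫⁻ t in Set.Ioi (0 : ℝ),
            volume {x | t < ‖f x‖} * ENNReal.ofReal (t ^ (p - 1)) :=
          lintegral_rpow_eq_lintegral_meas_lt_mul _ (Eventually.of_forall fun x => norm_nonneg _)
            hfm.norm.aemeasurable hp0
      _ ≤ ENNReal.ofReal p * ∫⁻ t in Set.Ioi (0 : ℝ), ∫⁻ ξ, F t ξ := by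
          refine mul_le_mul_right (setLIntegral_mono' measurableSet_Ioi fun t ht => hF1 t ht) _
      _ = ENNReal.ofReal p * ∫⁻ ξ, ∫⁻ t in Set.Ioi (0 : ℝ), F t ξ := by
          rw [lintegral_lintegral_swap hF2]
      _ ≤ ENNReal.ofReal p * ∫⁻ ξ, ENNReal.ofReal (4 * (A ^ (p - 2) / (p - 2))) *
            ‖((freq ξ ^ s : ℝ) : ℂ) * g ξ‖ₑ ^ 2 :=
          mul_le_mul_right (lintegral_mono hF3) _
      _ ≤ ENNReal.ofReal p * (ENNReal.ofReal (4 * (A ^ (p - 2) / (p - 2))) *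
            ENNReal.ofReal N ^ 2) := by
          rw [lintegral_const_mul' _ _ ENNReal.ofReal_ne_top, lintegral_enorm_sq]
          gcongr
      _ = ENNReal.ofReal (D * N ^ p) := by
          rw [← ENNReal.ofReal_pow hN.le, ← ENNReal.ofReal_mul (by positivity),
            ← ENNReal.ofReal_mul hp0.le]
          congr 1
          have h1 : N ^ p = N ^ (p - 2) * N ^ 2 := by
            rw [← Real.rpow_natCast, ← Real.rpow_add hN]; congr 1; push_cast; ring
          simp only [A, D]
          rw [h1, Real.mul_rpow (by positivity) hN.le]
          ring
  rw [eLpNorm_eq_lintegral_rpow_enorm_toReal (by simpa using hp0) ENNReal.ofReal_ne_top,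
    ENNReal.toReal_ofReal hp0.le]
  refine (ENNReal.rpow_le_rpow hmain (by positivity)).trans (le_of_eq ?_)
  rw [ENNReal.ofReal_rpow_of_nonneg (by positivity) (by positivity),
    Real.mul_rpow (by positivity) (by positivity), ← Real.rpow_mul hN.le,
    mul_one_div_cancel hp0.ne', Real.rpow_one]

end SobolevEmbedding

/-! ### From smallness of inner products to smallness in `L^q` -/

noncomputable section Remainder

set_option linter.unusedSectionVars false

variable {V : Type*} [NormedAddCommGroup V] [InnerProductSpace ℝ V] [MeasurableSpace V]
  [BorelSpace V] [FiniteDimensional ℝ V]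

/-- The Fourier weight `(2π|ξ|)^γ + (2π|ξ|)²` of the space `Ḣ^γ ∩ Ḣ²`. -/
def weight (γ : ℝ) (ξ : V) : ℝ := freq ξ ^ γ + freq ξ ^ (2 : ℝ)

theorem weight_nonneg (γ : ℝ) (ξ : V) : 0 ≤ weight γ ξ :=
  add_nonneg (Real.rpow_nonneg (freq_nonneg ξ) _) (Real.rpow_nonneg (freq_nonneg ξ) _)

theorem weight_pos (γ : ℝ) {ξ : V} (h : ξ ≠ 0) : 0 < weight γ ξ :=
  add_pos (Real.rpow_pos_of_pos (freq_pos h) _) (Real.rpow_pos_of_pos (freq_pos h) _)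

theorem measurable_weight (γ : ℝ) : Measurable (weight (V := V) γ) :=
  (measurable_freq.pow_const _).add (measurable_freq.pow_const _)

theorem rpow_le_weight_left (γ : ℝ) (ξ : V) : freq ξ ^ γ ≤ weight γ ξ :=
  le_add_of_nonneg_right (Real.rpow_nonneg (freq_nonneg ξ) _)

theorem rpow_le_weight_right (γ : ℝ) (ξ : V) : freq ξ ^ (2 : ℝ) ≤ weight γ ξ :=
  le_add_of_nonneg_left (Real.rpow_nonneg (freq_nonneg ξ) _)

/-- The symbol of `|∇|^s` relative to the weight. -/
def relSymbol (γ s : ℝ) (ξ : V) : ℂ := ((freq ξ ^ s * (weight γ ξ)⁻¹ : ℝ) : ℂ)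

theorem measurable_relSymbol (γ s : ℝ) : Measurable (relSymbol (V := V) γ s) :=
  Complex.measurable_ofReal.comp ((measurable_freq.pow_const _).mul (measurable_weight γ).inv)

theorem norm_relSymbol (γ s : ℝ) (ξ : V) : ‖relSymbol γ s ξ‖ = freq ξ ^ s * (weight γ ξ)⁻¹ := by
  rw [relSymbol, Complex.norm_real, Real.norm_of_nonneg
    (mul_nonneg (Real.rpow_nonneg (freq_nonneg ξ) _) (inv_nonneg.2 (weight_nonneg γ ξ)))]

theorem norm_relSymbol_le_one {γ s : ℝ} (hs : s = γ ∨ s = 2) (ξ : V) : ‖relSymbol γ s ξ‖ ≤ 1 := by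
  rw [norm_relSymbol, ← div_eq_mul_inv]
  refine div_le_one_of_le₀ ?_ (weight_nonneg γ ξ)
  rcases hs with rfl | rfl
  exacts [rpow_le_weight_left _ ξ, rpow_le_weight_right γ ξ]

/-- The Fourier transform attached to a square integrable weighted one. -/
def unweight (γ : ℝ) (h : V → ℂ) (ξ : V) : ℂ := (((weight γ ξ)⁻¹ : ℝ) : ℂ) * h ξ

theorem aestronglyMeasurable_unweight (γ : ℝ) {h : V → ℂ} (hh : AEStronglyMeasurable h volume) :
    AEStronglyMeasurable (unweight γ h) volume :=
  (Complex.measurable_ofReal.comp (measurable_weight γ).inv).aestronglyMeasurable.mul hh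

theorem rpow_mul_unweight (γ s : ℝ) (h : V → ℂ) (ξ : V) :
    ((freq ξ ^ s : ℝ) : ℂ) * unweight γ h ξ = relSymbol γ s ξ * h ξ := by
  rw [unweight, relSymbol, Complex.ofReal_mul, mul_assoc]

/-- The frequency shell `1/(K+1) ≤ 2π|ξ| ≤ K+1`. -/
def shell (V : Type*) [NormedAddCommGroup V] (K : ℕ) : Set V :=
  {ξ | ((K : ℝ) + 1)⁻¹ ≤ freq ξ ∧ freq ξ ≤ (K : ℝ) + 1}

theorem measurableSet_shell (K : ℕ) : MeasurableSet (shell V K) :=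
  (measurableSet_le measurable_const measurable_freq).inter
    (measurableSet_le measurable_freq measurable_const)

theorem volume_shell_lt_top (K : ℕ) : volume (shell V K) < ⊤ := by
  refine (measure_mono ?_).trans_lt (measure_closedBall_lt_top (x := (0 : V)) (r := (K : ℝ) + 1))
  intro ξ hξ
  rw [mem_closedBall_zero_iff]
  exact (norm_le_freq ξ).trans hξ.2

theorem inv_weight_le_of_mem_shell (γ : ℝ) {K : ℕ} {ξ : V} (hξ : ξ ∈ shell V K) :
    (weight γ ξ)⁻¹ ≤ ((K : ℝ) + 1) ^ 2 := by
  have h0 : (0 : ℝ) < (K : ℝ) + 1 := by positivity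
  have h1 : (((K : ℝ) + 1) ^ 2)⁻¹ ≤ weight γ ξ := by
    refine le_trans ?_ (rpow_le_weight_right γ ξ)
    rw [Real.rpow_two, ← inv_pow]
    exact pow_le_pow_left₀ (by positivity) hξ.1 2
  rw [← inv_inv (((K : ℝ) + 1) ^ 2)]
  exact inv_anti₀ (by positivity) h1

theorem memLp_shell_indicator (γ : ℝ) (K : ℕ) :
    MemLp ((shell V K).indicator fun ξ => (((weight γ ξ)⁻¹ : ℝ) : ℂ)) 2 volume := by
  have h1 : MemLp ((shell V K).indicator fun _ => ((((K : ℝ) + 1) ^ 2 : ℝ) : ℂ)) 2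
      (volume : Measure V) :=
    memLp_indicator_const 2 (measurableSet_shell K) _ (Or.inr (volume_shell_lt_top K).ne)
  refine h1.of_le ((Complex.measurable_ofReal.comp (measurable_weight γ).inv).indicator
    (measurableSet_shell K)).aestronglyMeasurable (Eventually.of_forall fun ξ => ?_)
  by_cases h : ξ ∈ shell V K
  · rw [Set.indicator_of_mem h, Set.indicator_of_mem h, Complex.norm_real, Complex.norm_real,
      Real.norm_of_nonneg (inv_nonneg.2 (weight_nonneg γ ξ)), Real.norm_of_nonneg (by positivity)]
    exact inv_weight_le_of_mem_shell γ h
  · simp [Set.indicator_of_notMem h]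

/-- The vector that tests the shell component of a function at the origin. -/
def shellVector (γ : ℝ) (K : ℕ) : Lp ℂ 2 (volume : Measure V) := (memLp_shell_indicator γ K).toLp

/-- The bridge to the Hilbert space: pointwise values of the shell component are inner products of
translates of `h` with one fixed vector. -/
theorem fourierInv_shell_unweight (γ : ℝ) (K : ℕ) (h : Lp ℂ 2 (volume : Measure V)) (x : V) :
    𝓕⁻ ((shell V K).indicator (unweight γ h)) x =
      inner ℂ (shellVector γ K) (modulation (-x) h) := by
  rw [inner_modulation, Real.fourierInv_eq]
  refine integral_congr_ae ?_
  filter_upwards [(memLp_shell_indicator (V := V) γ K).coeFn_toLp] with ξ hξ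
  rw [shellVector, hξ, inner_neg_right, neg_neg]
  congr 1
  by_cases h : ξ ∈ shell V K
  · rw [Set.indicator_of_mem h, Set.indicator_of_mem h, Complex.conj_ofReal, unweight]
  · rw [Set.indicator_of_notMem h, Set.indicator_of_notMem h, map_zero, zero_mul]

theorem integrable_shell_unweight (γ : ℝ) (K : ℕ) (h : Lp ℂ 2 (volume : Measure V)) :
    Integrable ((shell V K).indicator (unweight γ h)) := by
  refine ((memLp_shell_indicator (V := V) γ K).integrable_mul (Lp.memLp h)).congr
    (Eventually.of_forall fun ξ => ?_)
  by_cases hξ : ξ ∈ shell V K <;> simp [hξ, unweight]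

theorem eLpNorm_shell_unweight_le (γ : ℝ) (K : ℕ) {h : Lp ℂ 2 (volume : Measure V)} {N : ℝ}
    (hN : ‖h‖ ≤ N) : eLpNorm ((shell V K).indicator (unweight γ h)) 2 volume ≤
      ENNReal.ofReal (((K : ℝ) + 1) ^ 2 * N) := by
  have h1 : ∀ ξ, ‖(shell V K).indicator (unweight γ h) ξ‖ ≤ ((K : ℝ) + 1) ^ 2 * ‖h ξ‖ := by
    intro ξ
    by_cases hξ : ξ ∈ shell V K
    · rw [Set.indicator_of_mem hξ, unweight, norm_mul, Complex.norm_real,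
        Real.norm_of_nonneg (inv_nonneg.2 (weight_nonneg γ ξ))]
      gcongr
      exact inv_weight_le_of_mem_shell γ hξ
    · rw [Set.indicator_of_notMem hξ, norm_zero]
      positivity
  refine (eLpNorm_le_mul_eLpNorm_of_ae_le_mul (Eventually.of_forall h1) 2).trans ?_
  rw [ENNReal.ofReal_mul (by positivity), ← Lp.enorm_def, ← ofReal_norm]
  gcongr

/-- Interpolation between `L²` and `L^∞`. -/
theorem eLpNorm_le_of_norm_le {X : Type*} [MeasurableSpace X] {μ : Measure X} {f : X → ℂ} {δ q : ℝ}
    (hδ : ∀ x, ‖f x‖ ≤ δ) (hq : 2 < q) :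
    eLpNorm f (ENNReal.ofReal q) μ ≤
      (ENNReal.ofReal δ ^ (q - 2) * eLpNorm f 2 μ ^ 2) ^ (1 / q) := by
  have hq0 : 0 < q := by linarith
  rw [eLpNorm_eq_lintegral_rpow_enorm_toReal (by simpa using hq0) ENNReal.ofReal_ne_top,
    ENNReal.toReal_ofReal hq0.le]
  refine ENNReal.rpow_le_rpow ?_ (by positivity)
  rw [← lintegral_enorm_sq, ← lintegral_const_mul' _ _
    (ENNReal.rpow_ne_top_of_nonneg (by linarith) ENNReal.ofReal_ne_top)]
  refine lintegral_mono fun x => ?_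
  have h1 : ‖f x‖ₑ ≤ ENNReal.ofReal δ := by
    rw [← ofReal_norm]; exact ENNReal.ofReal_le_ofReal (hδ x)
  calc ‖f x‖ₑ ^ q = ‖f x‖ₑ ^ (q - 2) * ‖f x‖ₑ ^ 2 := by
        rw [← ENNReal.rpow_natCast, ← ENNReal.rpow_add_of_nonneg _ _ (by linarith) (by norm_num)]
        congr 1; push_cast; ring
    _ ≤ _ := by gcongr

/-- The size of `|∇|^s` relative to the weight outside the shell. -/
def shellError (γ s : ℝ) (K : ℕ) : ℝ := ((K : ℝ) + 1) ^ (-(s - γ)) + ((K : ℝ) + 1) ^ (-(2 - s))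

theorem shellError_pos (γ s : ℝ) (K : ℕ) : 0 < shellError γ s K := by
  unfold shellError; positivity

theorem tendsto_shellError {γ s : ℝ} (h1 : γ < s) (h2 : s < 2) :
    Tendsto (shellError γ s) atTop (𝓝 0) := by
  have h3 : Tendsto (fun K : ℕ => (K : ℝ) + 1) atTop atTop :=
    tendsto_atTop_add_const_right _ _ tendsto_natCast_atTop_atTop
  have h4 := ((tendsto_rpow_neg_atTop (y := s - γ) (by linarith)).comp h3).add
    ((tendsto_rpow_neg_atTop (y := 2 - s) (by linarith)).comp h3)
  rw [add_zero] at h4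
  exact h4

/-- Below the shell `freq^s` gains `freq^(s-γ)` over the first term of the weight; above it, it
gains `freq^(s-2)` over the second. -/
theorem norm_relSymbol_le_shellError {γ s : ℝ} (h1 : γ < s) (h2 : s < 2) {K : ℕ} {ξ : V}
    (hξ : ξ ∉ shell V K) (h0 : ξ ≠ 0) : ‖relSymbol γ s ξ‖ ≤ shellError γ s K := by
  have hK : (0 : ℝ) < (K : ℝ) + 1 := by positivity
  have hm := freq_pos h0
  rw [norm_relSymbol, ← div_eq_mul_inv, div_le_iff₀ (weight_pos γ h0), shellError]
  rcases lt_or_ge (freq ξ) ((K : ℝ) + 1)⁻¹ with h | h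
  · have h3 : freq ξ ^ (s - γ) ≤ ((K : ℝ) + 1) ^ (-(s - γ)) := by
      rw [Real.rpow_neg hK.le, ← Real.inv_rpow hK.le]
      exact Real.rpow_le_rpow hm.le h.le (by linarith)
    calc freq ξ ^ s = freq ξ ^ (s - γ) * freq ξ ^ γ := by
          rw [← Real.rpow_add hm]; congr 1; ring
      _ ≤ _ := mul_le_mul (h3.trans (le_add_of_nonneg_right (by positivity)))
          (rpow_le_weight_left γ ξ) (by positivity) (by positivity)
  · have h4 : (K : ℝ) + 1 < freq ξ := by
      by_contra! hcon
      exact hξ ⟨h, hcon⟩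
    have h3 : freq ξ ^ (-(2 - s)) ≤ ((K : ℝ) + 1) ^ (-(2 - s)) :=
      Real.rpow_le_rpow_of_nonpos hK h4.le (by linarith)
    calc freq ξ ^ s = freq ξ ^ (-(2 - s)) * freq ξ ^ (2 : ℝ) := by
          rw [← Real.rpow_add hm]; congr 1; ring
      _ ≤ _ := mul_le_mul (h3.trans (le_add_of_nonneg_left (by positivity)))
          (rpow_le_weight_right γ ξ) (by positivity) (by positivity)

/-- A bounded family in `Ḣ^γ ∩ Ḣ²` is small in `L^q`, `q = 2n / (n - 2s)` with `γ < s < 2`, as soon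
as its components in large frequency shells are uniformly small. -/
theorem exists_eLpNorm_le_shell [Nontrivial V] {γ s : ℝ} (h0 : 0 < γ) (h1 : γ < s) (h2 : s < 2)
    (hs : s < (Module.finrank ℝ V : ℝ) / 2) :
    ∃ C : ℝ, 0 < C ∧ ∀ (K : ℕ) (h : Lp ℂ 2 (volume : Measure V)) (f : V → ℂ) (N δ : ℝ), 0 < N →
      ‖h‖ ≤ N → HasFourier f (unweight γ h) →
      (∀ y, ‖inner ℂ (shellVector γ K) (modulation y h)‖ ≤ δ) →
      eLpNorm f (ENNReal.ofReal (2 * (Module.finrank ℝ V : ℝ) /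
        ((Module.finrank ℝ V : ℝ) - 2 * s))) volume ≤
      ENNReal.ofReal (C * (shellError γ s K * N)) +
        (ENNReal.ofReal δ ^ (2 * (Module.finrank ℝ V : ℝ) / ((Module.finrank ℝ V : ℝ) - 2 * s) - 2) *
          ENNReal.ofReal (((K : ℝ) + 1) ^ 2 * N) ^ 2) ^
          (1 / (2 * (Module.finrank ℝ V : ℝ) / ((Module.finrank ℝ V : ℝ) - 2 * s))) := by
  obtain ⟨C, hC, hsob⟩ := exists_eLpNorm_le_of_hasFourier (V := V) (h0.trans h1) hs
  refine ⟨C, hC, fun K h f N δ hN hhN hf hδ => ?_⟩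
  set q : ℝ := 2 * (Module.finrank ℝ V : ℝ) / ((Module.finrank ℝ V : ℝ) - 2 * s) with hq
  have hq2 : 2 < q := by
    rw [hq, lt_div_iff₀ (by linarith)]
    linarith
  let fm : V → ℂ := 𝓕⁻ ((shell V K).indicator (unweight γ h))
  have hfm : HasFourier fm ((shell V K).indicator (unweight γ h)) :=
    HasFourier.of_integrable (integrable_shell_unweight γ K h)
  have hfmδ : ∀ x, ‖fm x‖ ≤ δ := fun x => by
    simp only [fm, fourierInv_shell_unweight]
    exact hδ (-x)
  have hgmem : AEStronglyMeasurable (unweight γ h) volume :=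
    aestronglyMeasurable_unweight γ (Lp.memLp h).1
  have hfm2 : eLpNorm fm 2 volume ≤ ENNReal.ofReal (((K : ℝ) + 1) ^ 2 * N) := by
    have h3 := eLpNorm_shell_unweight_le γ K hhN
    -- The `L²` norm is known for the Plancherel realization, which agrees almost everywhere with
    -- the integral `fm`.
    obtain ⟨f₂, -, h5, h6⟩ := HasFourier.exists_of_memLp_two
      ⟨hgmem.indicator (measurableSet_shell K), h3.trans_lt ENNReal.ofReal_lt_top⟩
    rw [eLpNorm_congr_ae (hfm.unique h6), h5]
    exact h3
  have hfr : HasFourier (fun x => f x - fm x) ((shell V K)ᶜ.indicator (unweight γ h)) := by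
    refine (hf.sub hfm).congr ae_eq_rfl (Eventually.of_forall fun ξ => ?_)
    exact sub_eq_of_eq_add' (indicator_add_indicator_compl _ _ _).symm
  have hfrN : eLpNorm (fun x => f x - fm x) (ENNReal.ofReal q) volume ≤
      ENNReal.ofReal (C * (shellError γ s K * N)) := by
    refine hsob _ _ _ (mul_pos (shellError_pos γ s K) hN)
      (hgmem.indicator (measurableSet_shell K).compl) hfr ?_
    have h3 : ∀ᵐ ξ : V, ‖((freq ξ ^ s : ℝ) : ℂ) * (shell V K)ᶜ.indicator (unweight γ h) ξ‖ ≤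
        shellError γ s K * ‖h ξ‖ := by
      filter_upwards [Measure.ae_ne volume (0 : V)] with ξ hξ0
      by_cases hξ : ξ ∈ shell V K
      · rw [Set.indicator_of_notMem (by simpa using hξ), mul_zero, norm_zero]
        exact mul_nonneg (shellError_pos γ s K).le (norm_nonneg _)
      · rw [Set.indicator_of_mem (by simpa using hξ), rpow_mul_unweight, norm_mul]
        gcongr
        exact norm_relSymbol_le_shellError h1 h2 hξ hξ0
    refine (eLpNorm_le_mul_eLpNorm_of_ae_le_mul h3 2).trans ?_
    rw [ENNReal.ofReal_mul (shellError_pos γ s K).le, ← Lp.enorm_def, ← ofReal_norm]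
    gcongr
  have hsum : f = fun x => (f x - fm x) + fm x := by funext x; ring
  rw [hsum]
  refine (eLpNorm_add_le hfr.locallyIntegrable.aestronglyMeasurable
    hfm.locallyIntegrable.aestronglyMeasurable ?_).trans (add_le_add hfrN ?_)
  · rw [← ENNReal.ofReal_one]
    exact ENNReal.ofReal_le_ofReal (by linarith)
  · refine (eLpNorm_le_of_norm_le hfmδ hq2).trans (ENNReal.rpow_le_rpow ?_ (by positivity))
    gcongr

end Remainder

/-! ### Exponents, realizations and norms in `Ḣ^γ ∩ Ḣ²` -/

noncomputable section Assembly

theorem gammaC_bounds {d : ℕ} (hd : 1 ≤ d) {α : ℝ} (hα : 8 / (d : ℝ) < α)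
    (hα' : ENNReal.ofReal α < twoUpperStar d) :
    0 < gammaC d α ∧ gammaC d α < 2 ∧ gammaC d α < (d : ℝ) / 2 := by
  have hd0 : (0 : ℝ) < d := by exact_mod_cast hd
  have hα0 : 0 < α := lt_trans (by positivity) hα
  have h1 : 4 / α < d / 2 := by
    rw [div_lt_iff₀ hd0] at hα
    rw [div_lt_div_iff₀ hα0 (by norm_num)]
    linarith
  have h2 : 0 < 4 / α := by positivity
  unfold gammaC
  refine ⟨by linarith, ?_, by linarith⟩
  by_cases h4 : d ≤ 4
  · have : (d : ℝ) ≤ 4 := by exact_mod_cast h4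
    linarith
  · rw [twoUpperStar, if_neg h4] at hα'
    have h5 : (0 : ℝ) < d - 4 := by
      have : (4 : ℝ) < d := by exact_mod_cast not_le.1 h4
      linarith
    have h6 := (ENNReal.ofReal_lt_ofReal_iff (by positivity)).1 hα'
    rw [lt_div_iff₀ h5] at h6
    have h7 : ((d : ℝ) - 4) / 2 < 4 / α := by
      rw [div_lt_div_iff₀ (by norm_num) hα0]
      linarith
    linarith

/-- Every exponent between `α_c` and `2 + 2^⋆` is a Sobolev exponent of some order in `(γ_c, 2)`. -/
theorem exists_sobolev_order {d : ℕ} (hd : 1 ≤ d) {α : ℝ} (hγ : gammaC d α < (d : ℝ) / 2)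
    {q : ℝ≥0∞} (hq : ENNReal.ofReal (alphaC d α) < q) (hq' : q < 2 + twoUpperStar d) :
    ∃ s : ℝ, gammaC d α < s ∧ s < 2 ∧ s < (d : ℝ) / 2 ∧
      q = ENNReal.ofReal (2 * (d : ℝ) / ((d : ℝ) - 2 * s)) := by
  have hd0 : (0 : ℝ) < d := by exact_mod_cast hd
  have hαc : 0 < alphaC d α := div_pos (by positivity) (by linarith)
  lift q to NNReal using (hq'.trans_le le_top).ne
  have hqα : alphaC d α < q := by
    rw [ENNReal.ofReal_lt_iff_lt_toReal hαc.le ENNReal.coe_ne_top] at hq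
    simpa using hq
  have hq0 : (0 : ℝ) < q := hαc.trans hqα
  -- The solution `s` of `q = 2d / (d - 2s)`.
  refine ⟨d / 2 - d / q, ?_, ?_, by linarith [div_pos hd0 hq0], ?_⟩
  · have h1 : (d : ℝ) / q < ((d : ℝ) - 2 * gammaC d α) / 2 := by
      rw [alphaC, div_lt_iff₀ (by linarith)] at hqα
      rw [div_lt_div_iff₀ hq0 (by norm_num)]
      linarith
    linarith
  · by_cases h4 : d ≤ 4
    · have : (d : ℝ) ≤ 4 := by exact_mod_cast h4
      linarith [div_pos hd0 hq0]
    · have h5 : (0 : ℝ) < d - 4 := by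
        have : (4 : ℝ) < d := by exact_mod_cast not_le.1 h4
        linarith
      rw [twoUpperStar, if_neg h4, ← ENNReal.ofReal_ofNat, ← ENNReal.ofReal_add (by norm_num)
        (by positivity), ← ENNReal.ofReal_coe_nnreal, ENNReal.ofReal_lt_ofReal_iff (by positivity)]
        at hq'
      -- For `d ≥ 5` the endpoint `2 + 2^⋆` is the Sobolev exponent of order two.
      have h6 : (2 : ℝ) + 8 / (d - 4) = 2 * d / (d - 4) := by field_simp; ring
      rw [h6, lt_div_iff₀ h5] at hq'
      have h7 : ((d : ℝ) - 4) / 2 < d / q := by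
        rw [div_lt_div_iff₀ (by norm_num) hq0]
        linarith
      linarith
  · rw [← ENNReal.ofReal_coe_nnreal]
    congr 1
    have : (d : ℝ) - 2 * (d / 2 - d / q) = 2 * d / q := by ring
    rw [this]
    field_simp

section Realize

variable {V : Type*} [NormedAddCommGroup V] [InnerProductSpace ℝ V] [MeasurableSpace V]
  [BorelSpace V] [FiniteDimensional ℝ V]

theorem eLpNorm_rpow_mul_unweight_le {γ s : ℝ} (hs : s = γ ∨ s = 2)
    (h : Lp ℂ 2 (volume : Measure V)) :
    eLpNorm (fun ξ => ((freq ξ ^ s : ℝ) : ℂ) * unweight γ h ξ) 2 volume ≤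
      ENNReal.ofReal ‖h‖ := by
  simp only [rpow_mul_unweight]
  rw [ofReal_norm, Lp.enorm_def]
  refine eLpNorm_mono fun ξ => ?_
  rw [norm_mul]
  exact mul_le_of_le_one_left (norm_nonneg _) (norm_relSymbol_le_one hs ξ)

theorem exists_hasFourier_unweight [Nontrivial V] {γ : ℝ} (h0 : 0 ≤ γ)
    (hγ : γ < (Module.finrank ℝ V : ℝ) / 2) (h : Lp ℂ 2 (volume : Measure V)) :
    ∃ f : V → ℂ, HasFourier f (unweight γ h) := by
  obtain ⟨K, -, hK⟩ := exists_frequency_splitting (V := V) h0 hγ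
  obtain ⟨f₁, f₂, -, -, -, hf⟩ := hK (unweight γ h) ‖h‖ 1 one_pos (norm_nonneg _)
    (aestronglyMeasurable_unweight γ (Lp.memLp h).1) (eLpNorm_rpow_mul_unweight_le (Or.inl rfl) h)
  exact ⟨_, hf⟩

theorem memLp_of_hasFourier_unweight [Nontrivial V] {γ : ℝ} (h0 : 0 < γ)
    (hγ : γ < (Module.finrank ℝ V : ℝ) / 2) {h : Lp ℂ 2 (volume : Measure V)} {f : V → ℂ}
    (hf : HasFourier f (unweight γ h)) :
    MemLp f (ENNReal.ofReal (2 * (Module.finrank ℝ V : ℝ) /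
      ((Module.finrank ℝ V : ℝ) - 2 * γ))) volume := by
  obtain ⟨C, -, hC⟩ := exists_eLpNorm_le_of_hasFourier (V := V) h0 hγ
  refine ⟨hf.locallyIntegrable.aestronglyMeasurable, (hC f _ (‖h‖ + 1) (by positivity)
    (aestronglyMeasurable_unweight γ (Lp.memLp h).1) hf ?_).trans_lt ENNReal.ofReal_lt_top⟩
  exact (eLpNorm_rpow_mul_unweight_le (Or.inl rfl) h).trans
    (ENNReal.ofReal_le_ofReal (by linarith))

/-- `|∇|^s`, `s ∈ {γ, 2}`, in terms of the weighted Fourier transform. -/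
def sobolevCLM (γ s : ℝ) (hs : s = γ ∨ s = 2) :
    Lp ℂ 2 (volume : Measure V) →L[ℂ] Lp ℂ 2 (volume : Measure V) :=
  mulCLM (relSymbol γ s) (measurable_relSymbol γ s).aestronglyMeasurable (norm_relSymbol_le_one hs)

theorem hasFourier_remainder {γ : ℝ} {w : V → ℂ} {h : ℕ → Lp ℂ 2 (volume : Measure V)} {n : ℕ}
    (hw : HasFourier w (unweight γ (h n))) {P : ℕ → V → ℂ} {Q : ℕ → Lp ℂ 2 (volume : Measure V)}
    (hP : ∀ j, HasFourier (P j) (unweight γ (Q j))) (x : ℕ → ℕ → V) (l : ℕ) :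
    HasFourier (fun y => w y - ∑ j ∈ Finset.range l, P j (y - x j n))
      (unweight γ (IsDispersive.remainder modulation h x Q l n :
        Lp ℂ 2 (volume : Measure V))) := by
  induction l with
  | zero => simpa [IsDispersive.remainder] using hw
  | succ l ih =>
    refine (ih.sub ((hP l).translate (x l n))).congr (Eventually.of_forall fun y => ?_) ?_
    · simp only [Finset.sum_range_succ]
      ring
    · rw [IsDispersive.remainder_succ]
      filter_upwards [Lp.coeFn_sub (IsDispersive.remainder modulation h x Q l n)
        (modulation (x l n) (Q l)), coeFn_modulation (x l n) (Q l)] with ξ h1 h2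
      simp only [unweight]
      rw [h1, Pi.sub_apply, h2]
      ring

end Realize

section Norms

variable {d : ℕ}

theorem hdotENorm_pairing (hd : 1 ≤ d) {γ s : ℝ} (hs : s = γ ∨ s = 2)
    {h : Lp ℂ 2 (volume : Measure (EuclideanSpace ℝ (Fin d)))} {f : EuclideanSpace ℝ (Fin d) → ℂ}
    (hf : HasFourier f (unweight γ h)) :
    hdotENorm s (pairing f) = ENNReal.ofReal ‖sobolevCLM γ s hs h‖ := by
  rw [hdotENorm_eq hd s (hf.isFourierFunction (aestronglyMeasurable_unweight γ (Lp.memLp h).1)),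
    sobolevCLM, norm_mulCLM, ENNReal.ofReal_toReal
      (memLp_mul_of_norm_le_one (measurable_relSymbol γ s).aestronglyMeasurable
        (norm_relSymbol_le_one hs) (Lp.memLp h)).2.ne]
  exact congrArg (fun u => eLpNorm u 2 volume) (funext fun ξ => rpow_mul_unweight γ s h ξ)

theorem hdotNorm_pairing (hd : 1 ≤ d) {γ s : ℝ} (hs : s = γ ∨ s = 2)
    {h : Lp ℂ 2 (volume : Measure (EuclideanSpace ℝ (Fin d)))} {f : EuclideanSpace ℝ (Fin d) → ℂ}
    (hf : HasFourier f (unweight γ h)) : hdotNorm s (pairing f) = ‖sobolevCLM γ s hs h‖ := by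
  rw [hdotNorm, hdotENorm_pairing hd hs hf, ENNReal.toReal_ofReal (norm_nonneg _)]

/-- Both norms are computed from the same `g` by uniqueness, so `h = weight * g` is square
integrable; division by the weight is harmless off the origin. -/
theorem exists_weighted_fourier (hd : 1 ≤ d) {γ M : ℝ} {u : SchwartzZero d → ℂ}
    (h1 : hdotENorm γ u ≤ ENNReal.ofReal M) (h2 : hdotENorm 2 u ≤ ENNReal.ofReal M) :
    ∃ h : Lp ℂ 2 (volume : Measure (EuclideanSpace ℝ (Fin d))),
      ‖h‖ ≤ (ENNReal.ofReal M + ENNReal.ofReal M).toReal ∧ IsFourierFunction u (unweight γ h) := by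
  have : Nonempty (Fin d) := ⟨⟨0, hd⟩⟩
  obtain ⟨g, hg⟩ := exists_isFourierFunction_of_hdotENorm_lt_top (h1.trans_lt ENNReal.ofReal_lt_top)
  rw [hdotENorm_eq hd _ hg] at h1 h2
  have hm : ∀ s : ℝ, AEStronglyMeasurable
      (fun ξ : EuclideanSpace ℝ (Fin d) => ((freq ξ ^ s : ℝ) : ℂ) * g ξ) volume := fun s =>
    (Complex.measurable_ofReal.comp (measurable_freq.pow_const _)).aestronglyMeasurable.mul hg.1
  have h3 : eLpNorm (fun ξ => ((freq ξ ^ γ : ℝ) : ℂ) * g ξ + ((freq ξ ^ (2 : ℝ) : ℝ) : ℂ) * g ξ) 2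
      volume ≤ ENNReal.ofReal M + ENNReal.ofReal M :=
    (eLpNorm_add_le (hm γ) (hm 2) (by norm_num)).trans (add_le_add h1 h2)
  have h4 : MemLp (fun ξ => ((freq ξ ^ γ : ℝ) : ℂ) * g ξ + ((freq ξ ^ (2 : ℝ) : ℝ) : ℂ) * g ξ) 2
      volume := ⟨(hm γ).add (hm 2), h3.trans_lt (by finiteness)⟩
  refine ⟨h4.toLp, ?_, hg.congr ?_⟩
  · rw [Lp.norm_toLp]
    exact ENNReal.toReal_mono (by finiteness) h3
  · filter_upwards [h4.coeFn_toLp, Measure.ae_ne volume (0 : EuclideanSpace ℝ (Fin d))]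
      with ξ hξ hξ0
    rw [unweight, hξ, ← add_mul, ← Complex.ofReal_add, ← mul_assoc, ← Complex.ofReal_mul]
    change g ξ = (((weight γ ξ)⁻¹ * weight γ ξ : ℝ) : ℂ) * g ξ
    rw [inv_mul_cancel₀ (weight_pos γ hξ0).ne', Complex.ofReal_one, one_mul]

end Norms

/-- The order of choices is `K` first, then `l`, then `n`. -/
theorem tendsto_limsup_eLpNorm_zero {X : Type*} [MeasurableSpace X] {μ : Measure X} {q : ℝ≥0∞}
    {r : ℕ → ℕ → X → ℂ} {a : ℕ → ℝ≥0∞} {b : ℕ → ℕ → ℝ≥0∞} (ha : Tendsto a atTop (𝓝 0))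
    (hb : ∀ K, Tendsto (b K) atTop (𝓝 0))
    (h : ∀ K l, ∀ᶠ n in atTop, eLpNorm (r l n) q μ ≤ a K + b K l) :
    Tendsto (fun l => limsup (fun n => eLpNorm (r l n) q μ) atTop) atTop (𝓝 0) := by
  rw [ENNReal.tendsto_nhds_zero]
  intro ε hε
  have hε2 : 0 < ε / 2 := ENNReal.half_pos hε.ne'
  obtain ⟨K, hK⟩ := ((ENNReal.tendsto_nhds_zero.1 ha) _ hε2).exists
  filter_upwards [(ENNReal.tendsto_nhds_zero.1 (hb K)) _ hε2] with l hl
  refine limsup_le_of_le (by isBoundedDefault) ((h K l).mono fun n hn => hn.trans ?_)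
  exact (add_le_add hK hl).trans (ENNReal.add_halves ε).le

end Assembly

/-! ### The profile decomposition -/

theorem mainTheorem1 (d : ℕ) (hd : 1 ≤ d) (α : ℝ) (hα : 8 / (d : ℝ) < α)
    (hα' : ENNReal.ofReal α < twoUpperStar d)
    (v : ℕ → SchwartzZeroDual d)
    (hv : ∃ M : ℝ, ∀ n, hdotENorm (gammaC d α) (v n) ≤ ENNReal.ofReal M ∧
      hdotENorm 2 (v n) ≤ ENNReal.ofReal M) :
    ∃ (σ : ℕ → ℕ) (x : ℕ → ℕ → EuclideanSpace ℝ (Fin d))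
      (w : ℕ → EuclideanSpace ℝ (Fin d) → ℂ)
      (V : ℕ → EuclideanSpace ℝ (Fin d) → ℂ)
      (r : ℕ → ℕ → EuclideanSpace ℝ (Fin d) → ℂ),
      StrictMono σ ∧
      -- `w n` is the function in `L^{α_c}` that realises the element `v (σ n)`
      (∀ n, MemLp (w n) (ENNReal.ofReal (alphaC d α)) volume ∧ ⇑(v (σ n)) = pairing (w n)) ∧
      -- the profiles are functions in both homogeneous Sobolev spaces
      (∀ j, MemLp (V j) (ENNReal.ofReal (alphaC d α)) volume ∧
        hdotENorm (gammaC d α) (pairing (V j)) < ⊤ ∧ hdotENorm 2 (pairing (V j)) < ⊤) ∧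
      -- orthogonality of the translations
      (∀ k j, k ≠ j → Tendsto (fun n => ‖x k n - x j n‖) atTop atTop) ∧
      -- the decomposition, with remainders in both homogeneous Sobolev spaces
      (∀ l n y, w n y = ∑ j ∈ Finset.range l, V j (y - x j n) + r l n y) ∧
      (∀ l n, hdotENorm (gammaC d α) (pairing (r l n)) < ⊤ ∧
        hdotENorm 2 (pairing (r l n)) < ⊤) ∧
      -- smallness of the remainder
      (∀ q : ℝ≥0∞, ENNReal.ofReal (alphaC d α) < q → q < 2 + twoUpperStar d →
        Tendsto (fun l => limsup (fun n => eLpNorm (r l n) q volume) atTop) atTop (𝓝 0)) ∧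
      -- Pythagorean expansions
      (∀ l, Tendsto (fun n => hdotNorm (gammaC d α) (v (σ n)) ^ 2 -
          (∑ j ∈ Finset.range l, hdotNorm (gammaC d α) (pairing (V j)) ^ 2 +
            hdotNorm (gammaC d α) (pairing (r l n)) ^ 2)) atTop (𝓝 0)) ∧
      (∀ l, Tendsto (fun n => hdotNorm 2 (v (σ n)) ^ 2 -
          (∑ j ∈ Finset.range l, hdotNorm 2 (pairing (V j)) ^ 2 +
            hdotNorm 2 (pairing (r l n)) ^ 2)) atTop (𝓝 0)) := by
  have hne : Nonempty (Fin d) := ⟨⟨0, hd⟩⟩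
  obtain ⟨hγ0, hγ2, hγd⟩ := gammaC_bounds hd hα hα'
  have hfin : Module.finrank ℝ (EuclideanSpace ℝ (Fin d)) = d := by simp
  have hγd' : gammaC d α < (Module.finrank ℝ (EuclideanSpace ℝ (Fin d)) : ℝ) / 2 := by
    rwa [hfin]
  set γ := gammaC d α with hγ
  obtain ⟨M, hM⟩ := hv
  choose h hh hfour using fun n => exists_weighted_fourier hd (hM n).1 (hM n).2
  set C : ℝ := (ENNReal.ofReal M + ENNReal.ofReal M).toReal
  have hC0 : 0 ≤ C := ENNReal.toReal_nonneg
  -- One realization is fixed for each `h`. It respects sums and translations only almost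
  -- everywhere, so `r` below is defined as the exact difference, and the decomposition holds at
  -- every point.
  choose T hT using exists_hasFourier_unweight (V := EuclideanSpace ℝ (Fin d)) hγ0.le hγd'
  have hTmem : ∀ u, MemLp (T u) (ENNReal.ofReal (alphaC d α)) volume := fun u => by
    have := memLp_of_hasFourier_unweight hγ0 hγd' (hT u)
    rwa [hfin] at this
  have hvT : ∀ n, ⇑(v n) = pairing (T (h n)) := fun n => by
    funext φ
    rw [((hfour n).2 φ).2]
    exact ((hT (h n)).integral_eq φ).symm
  -- The two multipliers give the stated expansions; the identity bounds the remainders in the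
  -- weighted norm.
  let B : Option Bool → Lp ℂ 2 (volume : Measure (EuclideanSpace ℝ (Fin d))) →L[ℂ]
      Lp ℂ 2 (volume : Measure (EuclideanSpace ℝ (Fin d))) := fun i =>
    match i with
    | none => ContinuousLinearMap.id ℂ _
    | some true => sobolevCLM γ γ (Or.inl rfl)
    | some false => sobolevCLM γ 2 (Or.inr rfl)
  obtain ⟨σ, x, P, ε, hσ, hx, hε, hsmall, hpyth⟩ :=
    isDispersive_modulation.exists_profile_decomposition hh
      (shellVector (V := EuclideanSpace ℝ (Fin d)) γ) B (by
        rintro (_ | _ | _) y u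
        · rfl
        · exact mulCLM_modulation _ _ _ _ _
        · exact mulCLM_modulation _ _ _ _ _)
  let r : ℕ → ℕ → EuclideanSpace ℝ (Fin d) → ℂ := fun l n y =>
    T (h (σ n)) y - ∑ j ∈ Finset.range l, T (P j) (y - x j n)
  have hr : ∀ l n, HasFourier (r l n)
      (unweight γ (IsDispersive.remainder modulation (h ∘ σ) x P l n :
        Lp ℂ 2 (volume : Measure (EuclideanSpace ℝ (Fin d))))) := fun l n =>
    hasFourier_remainder (h := h ∘ σ) (hT (h (σ n))) (fun j => hT (P j)) x l
  have hfinite : ∀ (u : Lp ℂ 2 (volume : Measure (EuclideanSpace ℝ (Fin d))))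
      (f : EuclideanSpace ℝ (Fin d) → ℂ), HasFourier f (unweight γ u) →
      hdotENorm γ (pairing f) < ⊤ ∧ hdotENorm 2 (pairing f) < ⊤ := fun u f hf => by
    rw [hdotENorm_pairing hd (Or.inl rfl) hf, hdotENorm_pairing hd (Or.inr rfl) hf]
    exact ⟨ENNReal.ofReal_lt_top, ENNReal.ofReal_lt_top⟩
  refine ⟨σ, x, fun n => T (h (σ n)), fun j => T (P j), r, hσ, fun n => ⟨hTmem _, hvT _⟩,
    fun j => ⟨hTmem _, hfinite _ _ (hT _)⟩, hx, fun l n y => ?_, fun l n => hfinite _ _ (hr l n),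
    fun q hq hq' => ?_, fun l => ?_, fun l => ?_⟩
  · simp only [r]; ring
  · obtain ⟨s, hs1, hs2, hs3, rfl⟩ := exists_sobolev_order hd hγd hq hq'
    obtain ⟨A, hA, hbound⟩ := exists_eLpNorm_le_shell (V := EuclideanSpace ℝ (Fin d)) hγ0 hs1 hs2
      (by rwa [hfin])
    rw [hfin] at hbound
    set p : ℝ := 2 * (d : ℝ) / ((d : ℝ) - 2 * s) with hp
    have hd0 : (0 : ℝ) < d := by exact_mod_cast hd
    have hp2 : 2 < p := by
      rw [hp, lt_div_iff₀ (by linarith)]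
      linarith
    refine tendsto_limsup_eLpNorm_zero
      (a := fun K => ENNReal.ofReal (A * (shellError γ s K * (C + 1))))
      (b := fun K l => (ENNReal.ofReal (ε K l) ^ (p - 2) *
        ENNReal.ofReal (((K : ℝ) + 1) ^ 2 * (C + 1)) ^ 2) ^ (1 / p)) ?_ (fun K => ?_) (fun K l => ?_)
    · have h1 := ((tendsto_shellError hs1 hs2).mul_const (C + 1)).const_mul A
      rw [zero_mul, mul_zero] at h1
      simpa using ENNReal.tendsto_ofReal h1
    · have h1 := ENNReal.tendsto_ofReal (hε K)
      rw [ENNReal.ofReal_zero] at h1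
      have h2 := (ENNReal.continuous_rpow_const (y := p - 2)).tendsto 0 |>.comp h1
      rw [ENNReal.zero_rpow_of_pos (by linarith)] at h2
      have h3 := ENNReal.Tendsto.mul_const (b := ENNReal.ofReal (((K : ℝ) + 1) ^ 2 * (C + 1)) ^ 2)
        h2 (Or.inr (by finiteness))
      rw [zero_mul] at h3
      have h4 := (ENNReal.continuous_rpow_const (y := 1 / p)).tendsto 0 |>.comp h3
      rw [ENNReal.zero_rpow_of_pos (by positivity)] at h4
      exact h4
    · have h1 : ∀ᶠ n in atTop, ‖IsDispersive.remainder modulation (h ∘ σ) x P l n‖ ≤ C + 1 := by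
        filter_upwards [(hpyth none l).eventually (lt_mem_nhds (show (-1 : ℝ) < 0 by norm_num))]
          with n hn
        have hn : -1 < ‖h (σ n)‖ ^ 2 - (∑ j ∈ Finset.range l, ‖P j‖ ^ 2 +
          ‖IsDispersive.remainder modulation (h ∘ σ) x P l n‖ ^ 2) := hn
        have h2 : 0 ≤ ∑ j ∈ Finset.range l, ‖P j‖ ^ 2 := Finset.sum_nonneg fun _ _ => sq_nonneg _
        have h3 : ‖h (σ n)‖ ^ 2 ≤ C ^ 2 := pow_le_pow_left₀ (norm_nonneg _) (hh _) 2
        exact abs_le_of_sq_le_sq' (by nlinarith) (by linarith) |>.2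
      filter_upwards [h1, hsmall K l] with n hn1 hn2
      exact hbound K _ _ _ _ (by linarith) hn1 (hr l n) hn2
  · refine (hpyth (some true) l).congr fun n => ?_
    rw [hvT, hdotNorm_pairing hd (Or.inl rfl) (hT _), hdotNorm_pairing hd (Or.inl rfl) (hr l n)]
    simp only [hdotNorm_pairing hd (Or.inl rfl) (hT _)]
    rfl
  · refine (hpyth (some false) l).congr fun n => ?_
    rw [hvT, hdotNorm_pairing hd (Or.inr rfl) (hT _), hdotNorm_pairing hd (Or.inr rfl) (hr l n)]
    simp only [hdotNorm_pairing hd (Or.inr rfl) (hT _)]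
    rfl
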